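/- Let $n,p,q\in\mathbb N$, let $\sigma:\{1,\dots,q\}\to\mathbb Z_2^n\setminus\{0\}$, and let $\langle\cdot,\cdot\rangle$ be the standard scalar product of $\mathbb Z_2^n$. For $V\subset\mathbb R^p$ open, let $C^\infty(V)[[\xi^1,\dots,\xi^q]]_\sigma$ be the $\mathbb Z_2^n$-graded unital $\mathbb R$-algebra of formal power series, with coefficients in $C^\infty(V)$, in variables $\xi^a$ of degree $\sigma_a$ subject to $\xi^a\xi^b=(-1)^{\langle\sigma_a,\sigma_b\rangle}\xi^b\xi^a$. Let $(M,\mathcal A)$ be a $\mathbb Z_2^n$-supermanifold modelled on these data: $M$ is a Hausdorff second-countable topological space, $\mathcal A$ is a sheaf on $M$ of $\mathbb Z_2^n$-graded associative unital $\mathbb R$-algebras that are $\mathbb Z_2^n$-commutative ($ab=(-1)^{\langle\deg a,\deg b\rangle}ba$ for homogeneous $a,b$), and $M$ is covered by open subsets on which $(M,\mathcal A)$ is isomorphic, as a space with a sheaf of graded unital $\mathbb R$-algebras, to an open subset of $\mathbb R^p$ with the sheaf $V\mapsto C^\infty(V)[[\xi^1,\dots,\xi^q]]_\sigma$. (The stalks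 of $\mathcal A$ are then automatically local, i.e. have a unique maximal homogeneous ideal, and the isomorphisms respect these ideals.) For $U\subset M$ open, $f\in\mathcal A(U)$ and $m\in U$, let $\varepsilon_U(f)(m)$ be the unique $k\in\mathbb R$ such that $f-k$ is not invertible on any open neighbourhood of $m$ in $U$, and let $\mathcal J(U)=\ker\varepsilon_U$, a two-sided ideal of $\mathcal A(U)$; write $\mathcal J(U)^k$ for its $k$-th power. Then $\mathcal A$ and all the algebras $\mathcal A(U)$ are Hausdorff-complete for the $\mathcal J$-adic topology, in the following sense. 1. For every $k\in\mathbb N$ the quotient presheaf $\mathcal A/\mathcal J^k: U\mapsto\mathcal A(U)/\mathcal J(U)^k$ is a sheaf, and $\mathcal A$ together with the canonical projections $\mathcal A\to\mathcal A/\mathcal J^k$ is a limit of the inverse system $\mathcal A/\mathcal J\leftarrow\mathcal A/\mathcal J^2\leftarrow\mathcal A/\mathcal J^3\leftarrow\cdots$ in the category of sheaves of $\mathbb R$-algebras on $M$; that is, the canonical map $\mathcal A\to\varprojlim_k\mathcal A/\mathcal J^k$ is an isomorphism of sheaves. 2. For every open $U\subset M$, the canonical map $\mathcal A(U)\to\varprojlim_k\mathcal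 A(U)/\mathcal J(U)^k$ is bijective. -/

import Mathlib

open CategoryTheory CategoryTheory.Limits TopologicalSpace Opposite
open scoped Manifold ContDiff

set_option linter.unusedSectionVars false

universe u

noncomputable section

namespace Z2nGeometry

/-! ### The local model -/

/-- The standard scalar product `i₁ j₁ + ⋯ + iₙ jₙ` of `ℤ₂ⁿ`, with values in `ℕ`. -/
def pairing {n : ℕ} (g h : Fin n → ZMod 2) : ℕ :=
  ∑ i, (g i).val * (h i).val

section Series

variable {n q : ℕ} (σ : Fin q → Fin n → ZMod 2)

/-- The multi-indices `μ` of the monomials `ξ^μ` that may be non-zero: an odd variable `ξᵃ`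
(one with `⟨σ a, σ a⟩` odd) occurs with exponent at most `1`. -/
def IsReduced (μ : Fin q →₀ ℕ) : Prop :=
  ∀ a, Odd (pairing (σ a) (σ a)) → μ a ≤ 1

/-- The number (modulo `2`) of signs needed to reorder `ξ^ν ξ^ρ` into `ξ^(ν + ρ)`: every factor
`ξᵇ` of `ξ^ρ` has to pass all the factors `ξᵃ` of `ξ^ν` with `b < a`, and
`ξᵃ ξᵇ = (-1)^⟨σ a, σ b⟩ ξᵇ ξᵃ`. -/
def reorder (ν ρ : Fin q →₀ ℕ) : ℕ :=
  ∑ a, ∑ b ∈ Finset.univ.filter (· < a), pairing (σ a) (σ b) * ν a * ρ b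

/-- The degree in `ℤ₂ⁿ` of the monomial `ξ^μ`. -/
def monomialDegree (μ : Fin q →₀ ℕ) : Fin n → ZMod 2 :=
  ∑ a, μ a • σ a

/-- The formal power series `∑ f_μ ξ^μ` in the variables `ξ¹, …, ξ^q` of degrees `σ₁, …, σ_q` with
coefficients in `R`, as a submodule of the families of coefficients. -/
def seriesSubmodule (R : Type*) [CommRing R] : Submodule R ((Fin q →₀ ℕ) → R) where
  carrier := {f | ∀ μ, ¬ IsReduced σ μ → f μ = 0}
  add_mem' hf hg μ hμ := by simp [hf μ hμ, hg μ hμ]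
  zero_mem' _ _ := rfl
  smul_mem' c f hf μ hμ := by simp [hf μ hμ]

/-- The algebra `R[[ξ¹, …, ξ^q]]_σ` of formal power series in variables that commute according to
`ξᵃ ξᵇ = (-1)^⟨σ a, σ b⟩ ξᵇ ξᵃ`. -/
def FormalSeries (R : Type*) [CommRing R] : Type _ := seriesSubmodule σ R

namespace FormalSeries

variable {σ} {R S : Type*} [CommRing R] [CommRing S] [Algebra ℝ R] [Algebra ℝ S]

instance : AddCommGroup (FormalSeries σ R) := inferInstanceAs (AddCommGroup (seriesSubmodule σ R))

instance : Module ℝ (FormalSeries σ R) := inferInstanceAs (Module ℝ (seriesSubmodule σ R))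

/-- The coefficient `f_μ` of `ξ^μ`. -/
def coeff (f : FormalSeries σ R) (μ : Fin q →₀ ℕ) : R := f.1 μ

theorem ext {f g : FormalSeries σ R} (h : ∀ μ, f.coeff μ = g.coeff μ) : f = g :=
  Subtype.ext (funext h)

theorem coeff_of_not (f : FormalSeries σ R) {μ : Fin q →₀ ℕ} (h : ¬ IsReduced σ μ) :
    f.coeff μ = 0 := f.2 μ h

@[simp] theorem coeff_add (f g : FormalSeries σ R) (μ) :
    (f + g).coeff μ = f.coeff μ + g.coeff μ := rfl

@[simp] theorem coeff_zero (μ) : (0 : FormalSeries σ R).coeff μ = 0 := rfl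

@[simp] theorem coeff_neg (f : FormalSeries σ R) (μ) : (-f).coeff μ = -f.coeff μ := rfl

@[simp] theorem coeff_sub (f g : FormalSeries σ R) (μ) :
    (f - g).coeff μ = f.coeff μ - g.coeff μ := rfl

@[simp] theorem coeff_smul (c : ℝ) (f : FormalSeries σ R) (μ) :
    (c • f).coeff μ = c • f.coeff μ := rfl

/-- The constant series. -/
def const (r : R) : FormalSeries σ R :=
  ⟨fun μ => if μ = 0 then r else 0, fun μ hμ => by
    refine if_neg ?_
    rintro rfl
    exact hμ fun a _ => by simp⟩

theorem coeff_const (r : R) (μ) : (const r : FormalSeries σ R).coeff μ = if μ = 0 then r else 0 :=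
  rfl

instance : One (FormalSeries σ R) := ⟨const 1⟩

theorem one_def : (1 : FormalSeries σ R) = const 1 := rfl

open Classical in
/-- The product, `(f g)_α = ∑_{ν + ρ = α} ± f_ν g_ρ`, where `ξ^ν ξ^ρ = ± ξ^α`. -/
instance : Mul (FormalSeries σ R) :=
  ⟨fun f g => ⟨fun α => if IsReduced σ α then
      ∑ x ∈ Finset.HasAntidiagonal.antidiagonal α, (-1) ^ reorder σ x.1 x.2 * f.coeff x.1 * g.coeff x.2 else 0,
    fun _ h => if_neg h⟩⟩

theorem coeff_mul (f g : FormalSeries σ R) {α} (h : IsReduced σ α) :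
    (f * g).coeff α =
      ∑ x ∈ Finset.HasAntidiagonal.antidiagonal α, (-1) ^ reorder σ x.1 x.2 * f.coeff x.1 * g.coeff x.2 :=
  if_pos h

theorem ext_reduced {f g : FormalSeries σ R} (h : ∀ μ, IsReduced σ μ → f.coeff μ = g.coeff μ) :
    f = g := by
  refine ext fun μ => ?_
  by_cases hμ : IsReduced σ μ
  · exact h μ hμ
  · rw [coeff_of_not _ hμ, coeff_of_not _ hμ]

theorem isReduced_zero : IsReduced σ 0 := fun a _ => by simp

theorem IsReduced.left {α : Fin q →₀ ℕ} (h : IsReduced σ α) {x} (hx : x ∈ Finset.HasAntidiagonal.antidiagonal α) :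
    IsReduced σ x.1 := fun a ha => by
  have := h a ha
  rw [← Finset.HasAntidiagonal.mem_antidiagonal.1 hx, Finsupp.add_apply] at this
  omega

theorem IsReduced.right {α : Fin q →₀ ℕ} (h : IsReduced σ α) {x} (hx : x ∈ Finset.HasAntidiagonal.antidiagonal α) :
    IsReduced σ x.2 := fun a ha => by
  have := h a ha
  rw [← Finset.HasAntidiagonal.mem_antidiagonal.1 hx, Finsupp.add_apply] at this
  omega

theorem reorder_add_left (μ ν ρ : Fin q →₀ ℕ) :
    reorder σ (μ + ν) ρ = reorder σ μ ρ + reorder σ ν ρ := by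
  simp only [reorder, Finsupp.add_apply, mul_add, add_mul, Finset.sum_add_distrib]

theorem reorder_add_right (μ ν ρ : Fin q →₀ ℕ) :
    reorder σ μ (ν + ρ) = reorder σ μ ν + reorder σ μ ρ := by
  simp only [reorder, Finsupp.add_apply, mul_add, Finset.sum_add_distrib]

theorem reorder_zero_left (ρ : Fin q →₀ ℕ) : reorder σ 0 ρ = 0 := by simp [reorder]

theorem reorder_zero_right (ρ : Fin q →₀ ℕ) : reorder σ ρ 0 = 0 := by simp [reorder]

theorem const_mul_coeff (r : R) (f : FormalSeries σ R) (μ) :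
    (const r * f).coeff μ = r * f.coeff μ := by
  by_cases h : IsReduced σ μ
  · rw [coeff_mul _ _ h, Finset.sum_eq_single (0, μ)]
    · simp [coeff_const, reorder_zero_left]
    · rintro ⟨a, b⟩ hab hne
      have : a ≠ 0 := by
        rintro rfl
        apply hne
        simpa using hab
      simp [coeff_const, this]
    · simp
  · simp [coeff_of_not _ h]

theorem mul_const_coeff (r : R) (f : FormalSeries σ R) (μ) :
    (f * const r).coeff μ = f.coeff μ * r := by
  by_cases h : IsReduced σ μ
  · rw [coeff_mul _ _ h, Finset.sum_eq_single (μ, 0)]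
    · simp [coeff_const, reorder_zero_right]
    · rintro ⟨a, b⟩ hab hne
      have : b ≠ 0 := by
        rintro rfl
        apply hne
        simpa using hab
      simp [coeff_const, this]
    · simp
  · simp [coeff_of_not _ h]

protected theorem mul_assoc' (f g h : FormalSeries σ R) : f * g * h = f * (g * h) := by
  refine ext_reduced fun α hα => ?_
  rw [coeff_mul _ _ hα, coeff_mul _ _ hα]
  have h1 : ∀ x ∈ Finset.HasAntidiagonal.antidiagonal α,
      (-1) ^ reorder σ x.1 x.2 * (f * g).coeff x.1 * h.coeff x.2 =
      ∑ y ∈ Finset.HasAntidiagonal.antidiagonal x.1, (-1) ^ (reorder σ y.1 y.2 + reorder σ y.1 x.2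
        + reorder σ y.2 x.2) * (f.coeff y.1 * g.coeff y.2 * h.coeff x.2) := fun x hx => by
    rw [coeff_mul _ _ (IsReduced.left hα hx), Finset.mul_sum, Finset.sum_mul]
    refine Finset.sum_congr rfl fun y hy => ?_
    rw [← Finset.HasAntidiagonal.mem_antidiagonal.1 hy, reorder_add_left]
    ring
  have h2 : ∀ x ∈ Finset.HasAntidiagonal.antidiagonal α,
      (-1) ^ reorder σ x.1 x.2 * f.coeff x.1 * (g * h).coeff x.2 =
      ∑ y ∈ Finset.HasAntidiagonal.antidiagonal x.2, (-1) ^ (reorder σ x.1 y.1 + reorder σ x.1 y.2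
        + reorder σ y.1 y.2) * (f.coeff x.1 * g.coeff y.1 * h.coeff y.2) := fun x hx => by
    rw [coeff_mul _ _ (IsReduced.right hα hx), Finset.mul_sum]
    refine Finset.sum_congr rfl fun y hy => ?_
    rw [← Finset.HasAntidiagonal.mem_antidiagonal.1 hy, reorder_add_right]
    ring
  rw [Finset.sum_congr rfl h1, Finset.sum_congr rfl h2, Finset.sum_sigma', Finset.sum_sigma']
  refine Finset.sum_nbij' (fun x => ⟨(x.2.1, x.2.2 + x.1.2), (x.2.2, x.1.2)⟩)
    (fun x => ⟨(x.1.1 + x.2.1, x.2.2), (x.1.1, x.2.1)⟩) ?_ ?_ ?_ ?_ ?_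
  all_goals
    rintro ⟨⟨a, b⟩, ⟨c, d⟩⟩ hx
    simp only [Finset.mem_sigma, Finset.HasAntidiagonal.mem_antidiagonal] at hx
    obtain ⟨rfl, rfl⟩ := hx
    simp [add_assoc]

instance : Ring (FormalSeries σ R) where
  __ := (inferInstance : AddCommGroup (FormalSeries σ R))
  mul := (· * ·)
  one := 1
  left_distrib f g h := ext_reduced fun α hα => by
    simp [coeff_mul _ _ hα, mul_add, Finset.sum_add_distrib]
  right_distrib f g h := ext_reduced fun α hα => by
    simp [coeff_mul _ _ hα, mul_add, add_mul, Finset.sum_add_distrib]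
  zero_mul f := ext_reduced fun α hα => by simp [coeff_mul _ _ hα]
  mul_zero f := ext_reduced fun α hα => by simp [coeff_mul _ _ hα]
  mul_assoc := FormalSeries.mul_assoc'
  one_mul f := ext fun α => by rw [one_def, const_mul_coeff, one_mul]
  mul_one f := ext fun α => by rw [one_def, mul_const_coeff, mul_one]

instance : Algebra ℝ (FormalSeries σ R) :=
  Algebra.ofModule
    (fun c f g => ext_reduced fun α hα => by
      simp [coeff_mul _ _ hα, Finset.smul_sum])
    (fun c f g => ext_reduced fun α hα => by
      simp [coeff_mul _ _ hα, Finset.smul_sum])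

/-- Apply an algebra morphism to all coefficients. -/
def map (φ : R →ₐ[ℝ] S) : FormalSeries σ R →ₐ[ℝ] FormalSeries σ S :=
  AlgHom.ofLinearMap
    { toFun := fun f => ⟨fun μ => φ (f.coeff μ), fun μ hμ => by simp [coeff_of_not _ hμ]⟩
      map_add' := fun f g => ext fun μ => map_add φ (f.coeff μ) (g.coeff μ)
      map_smul' := fun c f => ext fun μ => map_smul φ c (f.coeff μ) }
    (ext fun μ => by
      change φ (coeff 1 μ) = coeff 1 μ
      simp only [one_def, coeff_const]
      split_ifs <;> simp)
    (fun f g => ext_reduced fun α hα => by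
      change φ ((f * g).coeff α) = _
      rw [coeff_mul _ _ hα, coeff_mul _ _ hα, map_sum]
      refine Finset.sum_congr rfl fun x _ => ?_
      rw [map_mul, map_mul, map_pow, map_neg, map_one]
      rfl)

@[simp] theorem coeff_map (φ : R →ₐ[ℝ] S) (f : FormalSeries σ R) (μ) :
    (map φ f).coeff μ = φ (f.coeff μ) := rfl

/-- The independent term, as a ring morphism. -/
def body : FormalSeries σ R →+* R where
  toFun f := f.coeff 0
  map_one' := by simp [one_def, coeff_const]
  map_mul' f g := by simp [coeff_mul _ _ isReduced_zero, reorder_zero_left]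
  map_zero' := rfl
  map_add' _ _ := rfl

theorem body_apply (f : FormalSeries σ R) : body f = f.coeff 0 := rfl

/-- The series that are homogeneous of degree `g`. -/
def homogeneous (g : Fin n → ZMod 2) : Submodule ℝ (FormalSeries σ R) where
  carrier := {f | ∀ μ, monomialDegree σ μ ≠ g → f.coeff μ = 0}
  add_mem' hf hg μ hμ := by simp [hf μ hμ, hg μ hμ]
  zero_mem' _ _ := rfl
  smul_mem' c f hf μ hμ := by simp [hf μ hμ]

theorem coeff_pow_eq_zero {v : FormalSeries σ R} (hv : v.coeff 0 = 0) (k : ℕ) :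
    ∀ μ : Fin q →₀ ℕ, μ.degree < k → (v ^ k).coeff μ = 0 := by
  induction k with
  | zero => intro μ h; simp at h
  | succ k ih =>
    intro μ h
    by_cases hμ : IsReduced σ μ
    · rw [pow_succ, coeff_mul _ _ hμ]
      refine Finset.sum_eq_zero fun x hx => ?_
      by_cases h2 : x.2 = 0
      · rw [h2, hv, mul_zero]
      · have h3 : x.1.degree + x.2.degree = μ.degree := by
          rw [← Finset.HasAntidiagonal.mem_antidiagonal.1 hx, map_add]
        have h4 : x.2.degree ≠ 0 := by
          rwa [Ne, Finsupp.degree_eq_zero_iff]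
        rw [ih x.1 (by omega)]
        simp
    · exact coeff_of_not _ hμ

theorem isUnit_one_sub {v : FormalSeries σ R} (hv : v.coeff 0 = 0) : IsUnit (1 - v) := by
  have coeff_sum : ∀ (N : ℕ) (μ : Fin q →₀ ℕ),
      (∑ k ∈ Finset.range N, v ^ k).coeff μ = ∑ k ∈ Finset.range N, (v ^ k).coeff μ := by
    intro N μ
    induction N with
    | zero => simp
    | succ N ih => simp [Finset.sum_range_succ, ih]
  let g : FormalSeries σ R := ⟨fun μ => (∑ k ∈ Finset.range (μ.degree + 1), v ^ k).coeff μ,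
    fun μ hμ => coeff_of_not _ hμ⟩
  have hg : ∀ (N : ℕ) (μ : Fin q →₀ ℕ), μ.degree ≤ N →
      g.coeff μ = (∑ k ∈ Finset.range (N + 1), v ^ k).coeff μ := by
    intro N μ h
    change (∑ k ∈ Finset.range (μ.degree + 1), v ^ k).coeff μ = _
    rw [coeff_sum, coeff_sum]
    refine Finset.sum_subset (fun x hx => by simp at hx ⊢; omega) fun k _ hk => ?_
    exact coeff_pow_eq_zero hv k μ (by simp at hk; omega)
  have hle : ∀ {α : Fin q →₀ ℕ} {x}, x ∈ Finset.HasAntidiagonal.antidiagonal α →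
      x.1.degree ≤ α.degree ∧ x.2.degree ≤ α.degree := fun {α x} hx => by
    rw [← Finset.HasAntidiagonal.mem_antidiagonal.1 hx, map_add]
    omega
  refine isUnit_iff_exists.2 ⟨g, ?_, ?_⟩
  · refine ext_reduced fun α hα => ?_
    have : ((1 - v) * g).coeff α =
        ((1 - v) * ∑ k ∈ Finset.range (α.degree + 1), v ^ k).coeff α := by
      rw [coeff_mul _ _ hα, coeff_mul _ _ hα]
      exact Finset.sum_congr rfl fun x hx => by rw [hg _ _ (hle hx).2]
    rw [this, mul_neg_geom_sum, coeff_sub, coeff_pow_eq_zero hv _ _ (Nat.lt_succ_self _), sub_zero]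
  · refine ext_reduced fun α hα => ?_
    have : (g * (1 - v)).coeff α =
        ((∑ k ∈ Finset.range (α.degree + 1), v ^ k) * (1 - v)).coeff α := by
      rw [coeff_mul _ _ hα, coeff_mul _ _ hα]
      exact Finset.sum_congr rfl fun x hx => by rw [hg _ _ (hle hx).1]
    rw [this, geom_sum_mul_neg, coeff_sub, coeff_pow_eq_zero hv _ _ (Nat.lt_succ_self _), sub_zero]

theorem isUnit_of_body {f : FormalSeries σ R} (hf : IsUnit (body f)) : IsUnit f := by
  obtain ⟨u, hu⟩ := hf
  have hu' : f.coeff 0 = u := hu.symm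
  have h1 : IsUnit (1 - (1 - const (↑u⁻¹ : R) * f)) := by
    refine isUnit_one_sub ?_
    simp [const_mul_coeff, one_def, coeff_const, hu']
  have h2 : IsUnit (const (u : R) : FormalSeries σ R) :=
    isUnit_iff_exists.2 ⟨const (↑u⁻¹ : R), ext fun μ => by
      rw [const_mul_coeff, one_def, coeff_const, coeff_const]; split_ifs <;> simp,
      ext fun μ => by
      rw [const_mul_coeff, one_def, coeff_const, coeff_const]; split_ifs <;> simp⟩
  have h3 : f = const (u : R) * (1 - (1 - const (↑u⁻¹ : R) * f)) := ext fun μ => by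
    rw [sub_sub_cancel, const_mul_coeff, const_mul_coeff]
    simp
  rw [h3]
  exact h2.mul h1

end FormalSeries

end Series

/-- The algebra `C^∞(V)` of smooth real functions on an open subset `V` of `ℝ^p`. -/
abbrev SmoothFunctions {p : ℕ} (V : Opens (EuclideanSpace ℝ (Fin p))) : Type :=
  C^∞⟮𝓘(ℝ, EuclideanSpace ℝ (Fin p)), V; 𝓘(ℝ, ℝ), ℝ⟯

/-- Restriction of smooth functions. -/
def SmoothFunctions.restrict {p : ℕ} {V W : Opens (EuclideanSpace ℝ (Fin p))} (h : W ≤ V) :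
    SmoothFunctions V →ₐ[ℝ] SmoothFunctions W :=
  { ContMDiffMap.restrictRingHom 𝓘(ℝ, EuclideanSpace ℝ (Fin p)) 𝓘(ℝ, ℝ) ℝ h with
    commutes' := fun _ => rfl }

/-- The algebra `C^∞(V)[[ξ¹, …, ξ^q]]_σ` of sections over `V ⊆ ℝ^p` of the structure sheaf of
the `ℤ₂ⁿ`-superdomain. -/
abbrev ModelSections {n q p : ℕ} (σ : Fin q → Fin n → ZMod 2)
    (V : Opens (EuclideanSpace ℝ (Fin p))) : Type :=
  FormalSeries σ (SmoothFunctions V)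

/-- The restriction maps of the structure sheaf of the `ℤ₂ⁿ`-superdomain: all coefficients are
restricted. -/
def ModelSections.restrict {n q p : ℕ} (σ : Fin q → Fin n → ZMod 2)
    {V W : Opens (EuclideanSpace ℝ (Fin p))} (h : W ≤ V) :
    ModelSections σ V →ₐ[ℝ] ModelSections σ W :=
  FormalSeries.map (SmoothFunctions.restrict h)

/-! ### `ℤ₂ⁿ`-ringed spaces and `ℤ₂ⁿ`-supermanifolds -/

/-- A `ℤ₂ⁿ`-ringed space structure on `M`: a sheaf of `ℤ₂ⁿ`-graded, `ℤ₂ⁿ`-commutative,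
associative and unital real algebras. -/
structure RingedSpace (n : ℕ) (M : TopCat.{u}) where
  /-- The underlying sheaf of real algebras. -/
  sheaf : TopCat.Sheaf (AlgCat.{u} ℝ) M
  /-- The sections over `U` that are homogeneous of degree `g`. -/
  degree (U : Opens M) (g : Fin n → ZMod 2) : Submodule ℝ (sheaf.presheaf.obj (op U))
  gradedMonoid (U : Opens M) : SetLike.GradedMonoid (degree U)
  isInternal (U : Opens M) : DirectSum.IsInternal (degree U)
  map_mem_degree {U V : Opens M} (h : V ≤ U) {g : Fin n → ZMod 2}
    {f : sheaf.presheaf.obj (op U)} (hf : f ∈ degree U g) :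
    (sheaf.presheaf.map (homOfLE h).op).hom f ∈ degree V g
  graded_comm {U : Opens M} {g h : Fin n → ZMod 2} {a b : sheaf.presheaf.obj (op U)}
    (ha : a ∈ degree U g) (hb : b ∈ degree U h) : a * b = (-1) ^ pairing g h * (b * a)

namespace RingedSpace

variable {n : ℕ} {M : TopCat.{u}} (A : RingedSpace n M)

/-- The algebra `A(U)`. -/
abbrev Sections (U : Opens M) : Type u := A.sheaf.presheaf.obj (op U)

/-- The restriction map `A(U) → A(V)`. -/
def res {U V : Opens M} (h : V ≤ U) : A.Sections U →ₐ[ℝ] A.Sections V :=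
  (A.sheaf.presheaf.map (homOfLE h).op).hom

theorem res_res {U V W : Opens M} (h : V ≤ U) (h' : W ≤ V) (f : A.Sections U) :
    A.res h' (A.res h f) = A.res (h'.trans h) f := by
  have := A.sheaf.presheaf.map_comp (homOfLE h).op (homOfLE h').op
  exact (congrArg (fun φ => φ.hom f) this).symm

theorem res_refl {U : Opens M} (f : A.Sections U) : A.res le_rfl f = f := by
  have := A.sheaf.presheaf.map_id (op U)
  exact congrArg (fun φ => φ.hom f) this

/-- The inverse image `φ⁻¹(V)` of an open set under a homeomorphism `φ` between open subsets of `M`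
and `ℝ^p`. -/
def chartPreimage {p : ℕ} (φ : OpenPartialHomeomorph M (EuclideanSpace ℝ (Fin p)))
    (V : Opens (EuclideanSpace ℝ (Fin p))) : Opens M :=
  ⟨φ.source ∩ φ ⁻¹' V, φ.isOpen_inter_preimage V.isOpen⟩

theorem chartPreimage_mono {p : ℕ} (φ : OpenPartialHomeomorph M (EuclideanSpace ℝ (Fin p)))
    {V W : Opens (EuclideanSpace ℝ (Fin p))} (h : W ≤ V) :
    chartPreimage φ W ≤ chartPreimage φ V :=
  fun _ hx => ⟨hx.1, h hx.2⟩

/-- A superchart of dimension `p` with formal variables of degrees `σ₁, …, σ_q`: a homeomorphism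
of an open subset of `M` onto an open subset of `ℝ^p`, covered by an isomorphism of sheaves of
`ℤ₂ⁿ`-graded unital real algebras (in the direction of the pullback of superfunctions). -/
structure Superchart {q : ℕ} (p : ℕ) (σ : Fin q → Fin n → ZMod 2) where
  /-- The underlying homeomorphism. -/
  chart : OpenPartialHomeomorph M (EuclideanSpace ℝ (Fin p))
  /-- The pullback of superfunctions. -/
  pullback (V : Opens (EuclideanSpace ℝ (Fin p))) (hV : (V : Set _) ⊆ chart.target) :
    ModelSections σ V ≃ₐ[ℝ] A.Sections (chartPreimage chart V)
  pullback_mem_degree_iff {V : Opens (EuclideanSpace ℝ (Fin p))}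
    (hV : (V : Set _) ⊆ chart.target) {g : Fin n → ZMod 2} {f : ModelSections σ V} :
    pullback V hV f ∈ A.degree _ g ↔ f ∈ FormalSeries.homogeneous g
  pullback_restrict {V W : Opens (EuclideanSpace ℝ (Fin p))}
    (hV : (V : Set _) ⊆ chart.target) (hW : (W : Set _) ⊆ chart.target) (h : W ≤ V)
    (f : ModelSections σ V) :
    pullback W hW (ModelSections.restrict σ h f) =
      A.res (chartPreimage_mono chart h) (pullback V hV f)

/-- `k` is a value at `m` of the base projection of `f ∈ A(U)`: the section `f - k` is invertible
in no open neighbourhood of `m` in `U`. On a `ℤ₂ⁿ`-supermanifold, this is true of exactly one real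
number `k`, which is denoted by `ε_U(f)(m)`. -/
def IsBaseValue {U : Opens M} (f : A.Sections U) (m : M) (k : ℝ) : Prop :=
  ∀ (V : Opens M) (h : V ≤ U), m ∈ V →
    ¬ IsUnit (A.res h (f - algebraMap ℝ (A.Sections U) k))

end RingedSpace

/-- A `ℤ₂ⁿ`-supermanifold structure on `M`, of dimension `p|𝐪`, where the components of `𝐪` are the
numbers of indices `a` with a given value of `σ a`: a `ℤ₂ⁿ`-ringed space that is locally
isomorphic to the `ℤ₂ⁿ`-superdomain `C^∞_{ℝ^p}[[ξ¹, …, ξ^q]]_σ`. (The stalks are then automatically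
local, and isomorphisms automatically respect their maximal homogeneous ideals.) -/
structure Supermanifold {n q : ℕ} (p : ℕ) (σ : Fin q → {g : Fin n → ZMod 2 // g ≠ 0})
    (M : TopCat.{u}) [T2Space M] [SecondCountableTopology M] extends RingedSpace n M where
  exists_superchart (m : M) :
    ∃ c : toRingedSpace.Superchart p (fun a => (σ a : Fin n → ZMod 2)), m ∈ c.chart.source

namespace RingedSpace.Superchart

variable {n q p : ℕ} {M : TopCat.{u}} {A : RingedSpace n M} {σ : Fin q → Fin n → ZMod 2}
  (c : A.Superchart p σ)

/-- The coordinates of the points of `U`. -/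
def image (U : Opens M) : Opens (EuclideanSpace ℝ (Fin p)) :=
  ⟨c.chart.target ∩ c.chart.symm ⁻¹' U, c.chart.isOpen_inter_preimage_symm U.isOpen⟩

theorem subset_target {U : Opens M} {V : Opens (EuclideanSpace ℝ (Fin p))} (h : V ≤ c.image U) :
    (V : Set (EuclideanSpace ℝ (Fin p))) ⊆ c.chart.target := fun _ hx => (h hx).1

theorem preimage_le {U : Opens M} {V : Opens (EuclideanSpace ℝ (Fin p))} (h : V ≤ c.image U) :
    chartPreimage c.chart V ≤ U := by
  rintro x ⟨hx, hx'⟩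
  have := (h hx').2
  rwa [Set.mem_preimage, c.chart.left_inv hx] at this

theorem mem_image {U : Opens M} {m : M} (hm : m ∈ c.chart.source) (hU : m ∈ U) :
    c.chart m ∈ c.image U :=
  ⟨c.chart.map_source hm, by rwa [Set.mem_preimage, c.chart.left_inv hm]⟩

/-- The coordinate form of `f`. -/
def coord {U : Opens M} {V : Opens (EuclideanSpace ℝ (Fin p))} (h : V ≤ c.image U) :
    A.Sections U →ₐ[ℝ] ModelSections σ V :=
  (c.pullback V (c.subset_target h)).symm.toAlgHom.comp (A.res (c.preimage_le h))

theorem pullback_coord {U : Opens M} {V : Opens (EuclideanSpace ℝ (Fin p))} (h : V ≤ c.image U)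
    (f : A.Sections U) :
    c.pullback V (c.subset_target h) (c.coord h f) = A.res (c.preimage_le h) f :=
  (c.pullback V (c.subset_target h)).apply_symm_apply _

/-- The value at `m` of the independent term of the coordinate form of `f`. -/
def value {U : Opens M} {m : M} (hm : m ∈ c.chart.source) (hU : m ∈ U) : A.Sections U →+* ℝ :=
  (ContMDiffMap.evalRingHom (⟨c.chart m, c.mem_image hm hU⟩ : c.image U)).comp
    ((FormalSeries.body (σ := σ) (R := SmoothFunctions (c.image U))).comp
      (c.coord (le_refl (c.image U))).toRingHom)

theorem coord_restrict {U : Opens M} {V W : Opens (EuclideanSpace ℝ (Fin p))}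
    (h : V ≤ c.image U) (h' : W ≤ V) (f : A.Sections U) :
    ModelSections.restrict σ h' (c.coord h f) = c.coord (h'.trans h) f := by
  apply (c.pullback W (c.subset_target (h'.trans h))).injective
  rw [c.pullback_restrict (c.subset_target h), pullback_coord, pullback_coord]
  exact A.res_res _ _ f

theorem coord_res {U U' : Opens M} {V : Opens (EuclideanSpace ℝ (Fin p))}
    (h : V ≤ c.image U) (h' : V ≤ c.image U') (hU : U' ≤ U) (f : A.Sections U) :
    c.coord h' (A.res hU f) = c.coord h f := by
  apply (c.pullback V (c.subset_target h)).injective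
  rw [pullback_coord, pullback_coord, A.res_res]

theorem value_eq {U : Opens M} {m : M} (hm : m ∈ c.chart.source) (hU : m ∈ U) (f : A.Sections U) :
    c.value hm hU f = (c.coord le_rfl f).coeff 0 ⟨c.chart m, c.mem_image hm hU⟩ := rfl

theorem value_res {U U' : Opens M} {m : M} (hm : m ∈ c.chart.source) (hU' : m ∈ U')
    (h : U' ≤ U) (f : A.Sections U) :
    c.value hm hU' (A.res h f) = c.value hm (h hU') f := by
  have h1 : c.image U' ≤ c.image U := fun x hx => ⟨hx.1, h hx.2⟩
  rw [value_eq, value_eq, c.coord_res h1, ← c.coord_restrict le_rfl h1]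
  rfl

theorem isBaseValue_zero_iff {U : Opens M} {m : M} (hm : m ∈ c.chart.source) (hU : m ∈ U)
    (f : A.Sections U) : A.IsBaseValue f m 0 ↔ c.value hm hU f = 0 := by
  simp only [IsBaseValue, map_zero, sub_zero]
  constructor
  · intro H
    by_contra hne
    let F : SmoothFunctions (c.image U) := (c.coord le_rfl f).coeff 0
    have hF : Continuous F := F.contMDiff.continuous
    let V : Opens (EuclideanSpace ℝ (Fin p)) :=
      ⟨Subtype.val '' {x : c.image U | F x ≠ 0},
        (c.image U).isOpen.isOpenMap_subtype_val _ (isOpen_ne_fun hF continuous_const)⟩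
    have hV : V ≤ c.image U := by
      rintro _ ⟨x, _, rfl⟩
      exact x.2
    refine H (chartPreimage c.chart V) (c.preimage_le hV)
      ⟨hm, ⟨⟨c.chart m, c.mem_image hm hU⟩, hne, rfl⟩⟩ ?_
    have h1 : IsUnit (c.coord hV f) := by
      refine FormalSeries.isUnit_of_body ?_
      have h2 : ∀ x : V, SmoothFunctions.restrict hV F x ≠ 0 := by
        rintro ⟨_, x, hx, rfl⟩
        exact hx
      have h3 : FormalSeries.body (c.coord hV f) = SmoothFunctions.restrict hV F := by
        rw [← c.coord_restrict le_rfl hV]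
        rfl
      rw [h3]
      refine IsUnit.of_mul_eq_one ⟨fun x => (SmoothFunctions.restrict hV F x)⁻¹,
        (SmoothFunctions.restrict hV F).contMDiff.inv₀ h2⟩ ?_
      ext x
      exact mul_inv_cancel₀ (h2 x)
    have h4 := h1.map (c.pullback V (c.subset_target hV))
    rwa [pullback_coord] at h4
  · intro H W hW hmW hu
    have := hu.map (c.value hm hmW)
    rw [value_res, H] at this
    exact not_isUnit_zero this

end RingedSpace.Superchart

namespace Supermanifold

variable {n q p : ℕ} {σ : Fin q → {g : Fin n → ZMod 2 // g ≠ 0}} {M : TopCat.{u}} [T2Space M]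
  [SecondCountableTopology M] (A : Supermanifold p σ M)

/-- The ideal `J(U) ⊆ A(U)`, the kernel of the base projection `ε_U`. -/
def J (U : Opens M) : Ideal (A.Sections U) where
  carrier := {f | ∀ m ∈ U, A.IsBaseValue f m 0}
  add_mem' {f g} hf hg m hm := by
    obtain ⟨c, hc⟩ := A.exists_superchart m
    rw [c.isBaseValue_zero_iff hc hm, map_add, (c.isBaseValue_zero_iff hc hm f).1 (hf m hm),
      (c.isBaseValue_zero_iff hc hm g).1 (hg m hm), add_zero]
  zero_mem' m hm := by
    obtain ⟨c, hc⟩ := A.exists_superchart m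
    rw [c.isBaseValue_zero_iff hc hm, map_zero]
  smul_mem' a f hf m hm := by
    obtain ⟨c, hc⟩ := A.exists_superchart m
    rw [c.isBaseValue_zero_iff hc hm, smul_eq_mul, map_mul,
      (c.isBaseValue_zero_iff hc hm f).1 (hf m hm), mul_zero]

theorem mem_J {U : Opens M} {f : A.Sections U} : f ∈ A.J U ↔ ∀ m ∈ U, A.IsBaseValue f m 0 :=
  Iff.rfl

instance (U : Opens M) : (A.J U).IsTwoSided where
  mul_mem_of_left {f} b hf m hm := by
    obtain ⟨c, hc⟩ := A.exists_superchart m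
    rw [c.isBaseValue_zero_iff hc hm, map_mul,
      (c.isBaseValue_zero_iff hc hm f).1 (hf m hm), zero_mul]

theorem res_mem_J {U V : Opens M} (h : V ≤ U) {f : A.Sections U} (hf : f ∈ A.J U) :
    A.res h f ∈ A.J V := fun m hm => by
  obtain ⟨c, hc⟩ := A.exists_superchart m
  rw [c.isBaseValue_zero_iff hc hm, c.value_res]
  exact (c.isBaseValue_zero_iff hc (h hm) f).1 (hf m (h hm))

theorem J_pow_le_comap {U V : Opens M} (h : V ≤ U) (k : ℕ) :
    A.J U ^ k ≤ (A.J V ^ k).comap (A.res h) := by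
  induction k with
  | zero => intro f _; simp [Submodule.pow_zero, Ideal.one_eq_top]
  | succ k ih =>
    rw [Submodule.pow_succ, Submodule.pow_succ, Ideal.mul_le]
    intro r hr s hs
    rw [Ideal.mem_comap, map_mul]
    exact Ideal.mul_mem_mul (ih hr) (A.res_mem_J h hs)

/-- The quotient presheaf `U ↦ A(U) / J(U)^k`. -/
def quotientPresheaf (k : ℕ) : TopCat.Presheaf (AlgCat.{u} ℝ) M where
  obj U := AlgCat.of ℝ (A.Sections U.unop ⧸ A.J U.unop ^ k)
  map i := AlgCat.ofHom
    (Ideal.quotientMapₐ _ (A.res (leOfHom i.unop)) (A.J_pow_le_comap (leOfHom i.unop) k))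
  map_id U := by
    ext x
    obtain ⟨f, rfl⟩ := Ideal.Quotient.mk_surjective x
    exact congrArg (Ideal.Quotient.mk _) (A.res_refl f)
  map_comp i j := by
    ext x
    obtain ⟨f, rfl⟩ := Ideal.Quotient.mk_surjective x
    exact congrArg (Ideal.Quotient.mk _)
      (A.res_res (leOfHom i.unop) (leOfHom j.unop) f).symm

/-- The projections `A(U) / J(U)^l → A(U) / J(U)^k` for `k ≤ l`. -/
def quotientTransition {k l : ℕ} (h : k ≤ l) : A.quotientPresheaf l ⟶ A.quotientPresheaf k where
  app U := AlgCat.ofHom (Ideal.Quotient.factorₐ ℝ (Ideal.pow_le_pow_right h))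
  naturality _ _ _ := by
    ext x
    obtain ⟨f, rfl⟩ := Ideal.Quotient.mk_surjective x
    rfl

/-- The projections `A(U) → A(U) / J(U)^k`. -/
def quotientProjection (k : ℕ) : A.sheaf.presheaf ⟶ A.quotientPresheaf k where
  app U := AlgCat.ofHom (Ideal.Quotient.mkₐ ℝ (A.J U.unop ^ k))
  naturality _ _ _ := rfl

/-- The inverse system `A/J ← A/J² ← A/J³ ← ⋯` in the category of sheaves of real algebras. -/
def quotientSystem (h : ∀ k, (A.quotientPresheaf k).IsSheaf) :
    ℕᵒᵖ ⥤ TopCat.Sheaf (AlgCat.{u} ℝ) M where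
  obj k := ⟨A.quotientPresheaf k.unop, h k.unop⟩
  map i := ObjectProperty.homMk (A.quotientTransition (leOfHom i.unop))
  map_id k := by
    apply Sheaf.hom_ext
    ext U x
    obtain ⟨f, rfl⟩ := Ideal.Quotient.mk_surjective x
    rfl
  map_comp i j := by
    apply Sheaf.hom_ext
    ext U x
    obtain ⟨f, rfl⟩ := Ideal.Quotient.mk_surjective x
    rfl

/-- The sheaf `A`, together with the projections `A → A/J^k`, as a cone over the inverse system
of the sheaves `A/J^k`. -/
def quotientCone (h : ∀ k, (A.quotientPresheaf k).IsSheaf) : Cone (A.quotientSystem h) where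
  pt := A.sheaf
  π :=
    { app := fun k => ObjectProperty.homMk (A.quotientProjection k.unop)
      naturality := fun _ _ _ => rfl }

end Supermanifold

/-! ### Hausdorff-completeness -/

/-- The inverse limit of the algebras `R / I^k`. -/
def adicLimit {R : Type*} [Ring R] [Algebra ℝ R] (I : Ideal R) [I.IsTwoSided] :
    Subalgebra ℝ (∀ k : ℕ, R ⧸ I ^ k) where
  carrier := {s | ∀ k l : ℕ, ∀ h : k ≤ l,
    Ideal.Quotient.factorₐ ℝ (Ideal.pow_le_pow_right h) (s l) = s k}
  mul_mem' ha hb k l h := by simp only [Pi.mul_apply, map_mul, ha k l h, hb k l h]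
  add_mem' ha hb k l h := by simp only [Pi.add_apply, map_add, ha k l h, hb k l h]
  algebraMap_mem' r k l h := AlgHom.commutes _ r

/-- The canonical map from `R` to the inverse limit of the `R / I^k`. -/
def toAdicLimit {R : Type*} [Ring R] [Algebra ℝ R] (I : Ideal R) [I.IsTwoSided] :
    R →ₐ[ℝ] adicLimit I :=
  (AlgHom.pi fun k => Ideal.Quotient.mkₐ ℝ (I ^ k)).codRestrict _ fun _ _ _ _ => rfl

/-- `R` is Hausdorff-complete for the `I`-adic topology: the canonical map from `R` to the
inverse limit of the `R / I^k` is bijective. -/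
def IsHausdorffComplete {R : Type*} [Ring R] [Algebra ℝ R] (I : Ideal R) [I.IsTwoSided] : Prop :=
  Function.Bijective (toAdicLimit I)

end Z2nGeometry

end

/-!
Write `F^k(U) ⊆ A(U)` for the ideal of the sections whose coordinate forms in all charts only have
monomials `ξ^μ` with `|μ| ≥ k`. Membership in `F^k` is visibly local, and the theorem is easy for
the filtration `F` in place of the powers of `J`: the coefficient of `ξ^μ` in a sequence that is
Cauchy for `F` is eventually constant, so the sequence has a limit in every chart, and these limits
glue because the `F^k(U)` intersect in `0` (`Supermanifold.exists_limit`); and sections that agree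
on overlaps modulo `F^k` are glued by a partition of unity
(`Supermanifold.exists_glue_mod_orderIdeal`).

The point is therefore the equality `J(U)^k = F^k(U)` (`Supermanifold.J_pow_eq_orderIdeal`), for
the algebraic power of an ideal, whose elements are *finite* sums of products. In a chart it holds
because a series of order `k + 1` is a sum of `q` products `ξᵃ gₐ` with `gₐ` of order `k`. The same
is true on a disjoint union of chart domains, with the same number `q` of summands, as sections over
disjoint sets glue freely. The passage to an arbitrary `U` needs a *finite* cover of `U` by such
disjoint unions, which exists since `M` has finite covering dimension
(`Supermanifold.exists_colored_cover`). This is shown as follows. Take countably many bump sections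
`f i` over `U`, with base projections `g i`, such that the sets `{g i > 1}` cover `U`. By Baire's
theorem there are thresholds `t i ∈ (0, 1)` such that at most `p` of the hypersurfaces
`{g i = t i}` meet at any point, because `p + 1` smooth functions map a chart onto a set with dense
complement. The functions `g i - t i` then yield `p + 1` families of pairwise disjoint open sets
(`exists_disjoint_families`): a point is sorted according to the first `m` with `g m > t m` and the
set of those `i < m` with `g i = t i`.

Given such a cover by `W₁, …, W_N`, choose central sections `η_j` with support in `W_j` and without
common zero of their base projections. If `f = ∑ xₐ gₐ` on `W_j`, then
`η_j² f = ∑ (η_j xₐ) (η_j gₐ)` on all of `U`, where the factors on the right are extended by zero;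
and `∑ η_j²` is invertible.
-/

noncomputable section

namespace Z2nGeometry

/-! ### The order filtration on formal power series -/

namespace FormalSeries

variable {n q : ℕ} {σ : Fin q → Fin n → ZMod 2} {R S : Type*} [CommRing R] [CommRing S]
  [Algebra ℝ R] [Algebra ℝ S]

theorem coeff_sum {ι : Type*} (s : Finset ι) (f : ι → FormalSeries σ R) (μ : Fin q →₀ ℕ) :
    (∑ i ∈ s, f i).coeff μ = ∑ i ∈ s, (f i).coeff μ :=
  map_sum (AddMonoidHom.mk' (fun f : FormalSeries σ R => f.coeff μ) fun _ _ => rfl) f s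

/-- The left ideal of the series of order at least `k`: only monomials `ξ^μ` with `|μ| ≥ k`
occur. -/
def orderIdeal (σ : Fin q → Fin n → ZMod 2) (R : Type*) [CommRing R] [Algebra ℝ R] (k : ℕ) :
    Ideal (FormalSeries σ R) where
  carrier := {f | ∀ μ, μ.degree < k → f.coeff μ = 0}
  add_mem' hf hg μ hμ := by rw [coeff_add, hf μ hμ, hg μ hμ, add_zero]
  zero_mem' _ _ := rfl
  smul_mem' a f hf μ hμ := by
    by_cases h : IsReduced σ μ
    · rw [smul_eq_mul, coeff_mul _ _ h]
      refine Finset.sum_eq_zero fun x hx => ?_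
      rw [hf x.2 ?_, mul_zero]
      rw [← Finset.HasAntidiagonal.mem_antidiagonal.1 hx, map_add] at hμ
      omega
    · exact coeff_of_not _ h

theorem mem_orderIdeal {k : ℕ} {f : FormalSeries σ R} :
    f ∈ orderIdeal σ R k ↔ ∀ μ : Fin q →₀ ℕ, μ.degree < k → f.coeff μ = 0 := Iff.rfl

theorem mul_mem_orderIdeal {j k : ℕ} {f g : FormalSeries σ R} (hf : f ∈ orderIdeal σ R j)
    (hg : g ∈ orderIdeal σ R k) : f * g ∈ orderIdeal σ R (j + k) := by
  intro μ hμ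
  by_cases h : IsReduced σ μ
  · rw [coeff_mul _ _ h]
    refine Finset.sum_eq_zero fun x hx => ?_
    rw [← Finset.HasAntidiagonal.mem_antidiagonal.1 hx, map_add] at hμ
    by_cases h1 : x.1.degree < j
    · rw [hf x.1 h1, mul_zero, zero_mul]
    · rw [hg x.2 (by omega), mul_zero]
  · exact coeff_of_not _ h

theorem mem_orderIdeal_one {f : FormalSeries σ R} : f ∈ orderIdeal σ R 1 ↔ f.coeff 0 = 0 := by
  refine ⟨fun h => h 0 (by simp), fun h μ hμ => ?_⟩
  have : μ = 0 := (Finsupp.degree_eq_zero_iff μ).1 (by omega)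
  rw [this, h]

theorem const_commute (r : R) (f : FormalSeries σ R) : Commute (const r) f :=
  ext fun μ => by rw [const_mul_coeff, mul_const_coeff, mul_comm]

theorem map_const (φ : R →ₐ[ℝ] S) (r : R) :
    map φ (const r : FormalSeries σ R) = const (φ r) := ext fun μ => by
  rw [coeff_map, coeff_const, coeff_const]
  split_ifs <;> simp

/-- The variable `ξᵃ`. -/
def X (σ : Fin q → Fin n → ZMod 2) (R : Type*) [CommRing R] (a : Fin q) : FormalSeries σ R :=
  ⟨fun μ => if μ = Finsupp.single a 1 then 1 else 0, fun μ hμ => by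
    refine if_neg ?_
    rintro rfl
    refine hμ fun b _ => ?_
    rw [Finsupp.single_apply]
    split_ifs <;> omega⟩

theorem coeff_X (a : Fin q) (μ : Fin q →₀ ℕ) :
    (X σ R a).coeff μ = if μ = Finsupp.single a 1 then 1 else 0 := rfl

theorem coeff_X_zero (a : Fin q) : (X σ R a).coeff 0 = 0 := by
  rw [coeff_X, if_neg]
  exact fun h => by simpa using DFunLike.congr_fun h a

/-- The part of `f` made of the monomials whose first variable is `ξᵃ`, divided from the left by
`ξᵃ`. -/
def leftQuotient (a : Fin q) (f : FormalSeries σ R) : FormalSeries σ R :=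
  ⟨fun ν => if ∀ b < a, ν b = 0 then f.coeff (Finsupp.single a 1 + ν) else 0, fun ν hν => by
    have : ¬ IsReduced σ (Finsupp.single a 1 + ν) := fun h => hν fun b hb => by
      have := h b hb
      rw [Finsupp.add_apply] at this
      omega
    simp only [coeff_of_not _ this, ite_self]⟩

theorem coeff_leftQuotient (a : Fin q) (f : FormalSeries σ R) (ν : Fin q →₀ ℕ) :
    (leftQuotient a f).coeff ν =
      if ∀ b < a, ν b = 0 then f.coeff (Finsupp.single a 1 + ν) else 0 := rfl

theorem leftQuotient_mem {k : ℕ} {f : FormalSeries σ R} (hf : f ∈ orderIdeal σ R (k + 1))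
    (a : Fin q) : leftQuotient a f ∈ orderIdeal σ R k := fun ν hν => by
  rw [coeff_leftQuotient, hf _ (by rw [map_add, Finsupp.degree_single]; omega), ite_self]

/-- No sign arises on multiplying from the left by `ξᵃ` a monomial in the variables `ξᵇ` with
`b ≥ a`. -/
theorem reorder_single_left {a : Fin q} {ν : Fin q →₀ ℕ} (h : ∀ b < a, ν b = 0) :
    reorder σ (Finsupp.single a 1) ν = 0 := by
  refine Finset.sum_eq_zero fun a' _ => Finset.sum_eq_zero fun b hb => ?_
  by_cases ha : a = a'
  · subst ha
    rw [h b (Finset.mem_filter.1 hb).2, mul_zero]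
  · rw [Finsupp.single_eq_of_ne (Ne.symm ha), mul_zero, zero_mul]

theorem coeff_X_mul_leftQuotient (a : Fin q) (f : FormalSeries σ R) {α : Fin q →₀ ℕ}
    (hα : IsReduced σ α) : (X σ R a * leftQuotient a f).coeff α =
      if α a ≠ 0 ∧ ∀ b < a, α b = 0 then f.coeff α else 0 := by
  rw [coeff_mul _ _ hα]
  by_cases h : α a ≠ 0
  · have hle : Finsupp.single a 1 ≤ α := by
      rw [Finsupp.single_le_iff]
      omega
    have hadd : Finsupp.single a 1 + (α - Finsupp.single a 1) = α := add_tsub_cancel_of_le hle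
    have hiff : (∀ b < a, (α - Finsupp.single a 1 : Fin q →₀ ℕ) b = 0) ↔ ∀ b < a, α b = 0 := by
      refine forall₂_congr fun b hb => ?_
      rw [Finsupp.tsub_apply, Finsupp.single_eq_of_ne hb.ne, Nat.sub_zero]
    rw [Finset.sum_eq_single (Finsupp.single a 1, α - Finsupp.single a 1)]
    · simp only [coeff_X, if_true, mul_one, coeff_leftQuotient, hadd]
      by_cases h2 : ∀ b < a, α b = 0
      · rw [if_pos (hiff.2 h2), if_pos ⟨h, h2⟩, reorder_single_left (hiff.2 h2), pow_zero, one_mul]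
      · rw [if_neg (mt hiff.1 h2), if_neg (fun h3 => h2 h3.2), mul_zero]
    · rintro ⟨b, c⟩ hbc hne
      rw [coeff_X, if_neg, mul_zero, zero_mul]
      rintro rfl
      apply hne
      rw [← Finset.HasAntidiagonal.mem_antidiagonal.1 hbc]
      simp
    · intro h'
      exact absurd (Finset.HasAntidiagonal.mem_antidiagonal.2 hadd) h'
  · rw [if_neg (fun h3 => h h3.1)]
    refine Finset.sum_eq_zero fun x hx => ?_
    rw [coeff_X, if_neg, mul_zero, zero_mul]
    intro h1
    rw [← Finset.HasAntidiagonal.mem_antidiagonal.1 hx, h1] at h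
    simp at h

/-- A series without constant term is a combination of the variables: every monomial is
attributed to the first variable that occurs in it. -/
theorem eq_sum_X_mul {f : FormalSeries σ R} (hf : f.coeff 0 = 0) :
    f = ∑ a, X σ R a * leftQuotient a f := by
  refine ext_reduced fun α hα => ?_
  rw [coeff_sum, Finset.sum_congr rfl fun a _ => coeff_X_mul_leftQuotient a f hα]
  by_cases h0 : α = 0
  · subst h0
    simp [hf]
  · have hne : α.support.Nonempty := Finsupp.support_nonempty_iff.2 h0
    have hmin : ∀ b < α.support.min' hne, α b = 0 := fun b hb => by
      by_contra hb'
      exact absurd (Finset.min'_le _ _ (Finsupp.mem_support_iff.2 hb')) (not_le.2 hb)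
    have hmem : α (α.support.min' hne) ≠ 0 :=
      Finsupp.mem_support_iff.1 (Finset.min'_mem _ hne)
    rw [Finset.sum_eq_single (α.support.min' hne), if_pos ⟨hmem, hmin⟩]
    · rintro b - hb
      refine if_neg fun ⟨h1, h2⟩ => ?_
      rcases lt_or_gt_of_ne hb with h | h
      · exact h1 (hmin b h)
      · exact hmem (h2 _ h)
    · simp

end FormalSeries

/-! ### Gluing of sections -/

namespace RingedSpace

variable {n : ℕ} {M : TopCat.{u}} (A : RingedSpace n M)

theorem ext_of_locally {U : Opens M} {f g : A.Sections U}
    (h : ∀ m ∈ U, ∃ (V : Opens M) (hV : V ≤ U), m ∈ V ∧ A.res hV f = A.res hV g) : f = g := by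
  choose V hV hm hVe using h
  refine A.sheaf.eq_of_locally_eq' (fun m : U => V m.1 m.2) U (fun m => homOfLE (hV m.1 m.2))
    (fun m hm' => ?_) f g fun m => hVe m.1 m.2
  exact Opens.mem_iSup.2 ⟨⟨m, hm'⟩, hm m hm'⟩

theorem ext_of_isEmpty {U : Opens M} (hU : ∀ m, m ∉ U) (f g : A.Sections U) : f = g :=
  A.ext_of_locally fun m hm => absurd hm (hU m)

theorem exists_glue {ι : Type*} {U : Opens M} (V : ι → Opens M) (hV : ∀ i, V i ≤ U)
    (hU : U ≤ iSup V) (s : ∀ i, A.Sections (V i))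
    (h : ∀ i j, A.res inf_le_left (s i) = A.res (inf_le_right : V i ⊓ V j ≤ V j) (s j)) :
    ∃ f : A.Sections U, ∀ i, A.res (hV i) f = s i :=
  (A.sheaf.existsUnique_gluing' V U (fun i => homOfLE (hV i)) hU s h).exists

/-- Sections over pairwise disjoint open sets glue without any condition. -/
theorem exists_glue_of_disjoint {ι : Type*} {U : Opens M} (V : ι → Opens M) (hV : ∀ i, V i ≤ U)
    (hU : U ≤ iSup V) (hd : Pairwise fun i j => Disjoint (V i) (V j))
    (s : ∀ i, A.Sections (V i)) : ∃ f : A.Sections U, ∀ i, A.res (hV i) f = s i := by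
  refine A.exists_glue V hV hU s fun i j => ?_
  by_cases hij : i = j
  · subst hij
    rfl
  · refine A.ext_of_isEmpty (fun m hm => ?_) _ _
    rw [(hd hij).eq_bot] at hm
    exact hm

/-- Extension by zero, to a union of two open sets, of a section that vanishes on their
intersection. -/
theorem exists_extend {U V V' : Opens M} (hV : V ≤ U) (hV' : V' ≤ U) (hU : U ≤ V ⊔ V')
    (s : A.Sections V) (hs : A.res (inf_le_left : V ⊓ V' ≤ V) s = 0) :
    ∃ f : A.Sections U, A.res hV f = s ∧ A.res hV' f = 0 := by
  obtain ⟨f, hf⟩ := A.exists_glue (U := U) (fun b : Bool => bif b then V else V')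
    (by rintro (_ | _) <;> assumption) (hU.trans_eq (sup_eq_iSup _ _))
    (fun b => match b with
      | true => s
      | false => (0 : A.Sections V')) (by
    rintro (_ | _) (_ | _)
    · rfl
    · refine Eq.trans (map_zero (A.res (inf_le_left : V' ⊓ V ≤ V'))) ?_
      have h := congrArg (A.res (inf_comm V' V).le) hs
      rw [A.res_res, map_zero] at h
      exact h.symm
    · exact hs.trans (map_zero (A.res (inf_le_right : V ⊓ V' ≤ V'))).symm
    · rfl)
  exact ⟨f, hf true, hf false⟩

/-- Invertibility of a section is a local property, because inverses are unique. -/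
theorem isUnit_of_locally {U : Opens M} {f : A.Sections U}
    (h : ∀ m ∈ U, ∃ (V : Opens M) (hV : V ≤ U), m ∈ V ∧ IsUnit (A.res hV f)) : IsUnit f := by
  choose V hV hm hu using h
  choose g hg hg' using fun m hm => isUnit_iff_exists.1 (hu m hm)
  have key : ∀ (m m' : U) (W : Opens M) (h : W ≤ V m.1 m.2) (h' : W ≤ V m'.1 m'.2),
      A.res h (g m.1 m.2) = A.res h' (g m'.1 m'.2) := fun m m' W h h' => by
    refine left_inv_eq_right_inv (a := A.res (h.trans (hV _ _)) f) ?_ ?_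
    · rw [← A.res_res (hV m.1 m.2) h, ← map_mul, hg', map_one]
    · rw [← A.res_res (hV m'.1 m'.2) h', ← map_mul, hg, map_one]
  obtain ⟨G, hG⟩ := A.exists_glue (U := U) (fun m : U => V m.1 m.2) (fun m => hV m.1 m.2)
    (fun m hm' => Opens.mem_iSup.2 ⟨⟨m, hm'⟩, hm m hm'⟩) (fun m => g m.1 m.2)
    fun i j => key i j _ _ _
  refine isUnit_iff_exists.2 ⟨G, ?_, ?_⟩
  · refine A.ext_of_locally fun m hm' => ⟨V m hm', hV m hm', hm m hm', ?_⟩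
    rw [map_mul, map_one, hG ⟨m, hm'⟩, hg]
  · refine A.ext_of_locally fun m hm' => ⟨V m hm', hV m hm', hm m hm', ?_⟩
    rw [map_mul, map_one, hG ⟨m, hm'⟩, hg']

/-- The section `f` and all its restrictions commute with all sections. -/
def IsCentral {U : Opens M} (f : A.Sections U) : Prop :=
  ∀ (V : Opens M) (hV : V ≤ U) (g : A.Sections V), A.res hV f * g = g * A.res hV f

theorem isCentral_of_locally {U : Opens M} {f : A.Sections U}
    (h : ∀ m ∈ U, ∃ (V : Opens M) (hV : V ≤ U), m ∈ V ∧ A.IsCentral (A.res hV f)) :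
    A.IsCentral f := fun W hW g => by
  refine A.ext_of_locally fun m hm => ?_
  obtain ⟨V, hV, hmV, hc⟩ := h m (hW hm)
  refine ⟨V ⊓ W, inf_le_right, ⟨hmV, hm⟩, ?_⟩
  have := hc (V ⊓ W) inf_le_left (A.res inf_le_right g)
  rw [A.res_res] at this
  rw [map_mul, map_mul, A.res_res]
  exact this

theorem isCentral_zero {U : Opens M} : A.IsCentral (0 : A.Sections U) := fun V hV g => by
  rw [map_zero, zero_mul, mul_zero]

theorem res_injective {U V : Opens M} (h : V ≤ U) (h' : U ≤ V) :
    Function.Injective (A.res h) := fun f g hfg => by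
  rw [← A.res_refl f, ← A.res_refl g, ← A.res_res h h', ← A.res_res h h', hfg]

theorem res_surjective {U V : Opens M} (h : V ≤ U) (h' : U ≤ V) :
    Function.Surjective (A.res h) := fun f => ⟨A.res h' f, by rw [A.res_res, A.res_refl]⟩

namespace Superchart

variable {A} {q p : ℕ} {σ : Fin q → Fin n → ZMod 2} (c : A.Superchart p σ)

theorem image_mono {U V : Opens M} (h : V ≤ U) : c.image V ≤ c.image U :=
  fun _ hx => ⟨hx.1, h hx.2⟩

theorem le_chartPreimage {U : Opens M} (hU : (U : Set M) ⊆ c.chart.source) :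
    U ≤ chartPreimage c.chart (c.image U) :=
  fun _ hm => ⟨hU hm, c.mem_image (hU hm) hm⟩

/-- Over an open subset of the domain of the chart, sections are the same as their coordinate
forms. -/
theorem coord_bijective {U : Opens M} (hU : (U : Set M) ⊆ c.chart.source) :
    Function.Bijective (c.coord (le_refl (c.image U))) :=
  (c.pullback _ _).symm.bijective.comp
    ⟨A.res_injective _ (c.le_chartPreimage hU), A.res_surjective _ (c.le_chartPreimage hU)⟩

theorem coord_res_eq {U V : Opens M} (h : V ≤ U) (f : A.Sections U) :
    c.coord le_rfl (A.res h f) =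
      ModelSections.restrict σ (c.image_mono h) (c.coord le_rfl f) := by
  rw [c.coord_restrict, c.coord_res (c.image_mono h)]

theorem coeff_coord_res {U V : Opens M} (h : V ≤ U) (f : A.Sections U) (μ : Fin q →₀ ℕ)
    (x : c.image V) : (c.coord le_rfl (A.res h f)).coeff μ x =
      (c.coord le_rfl f).coeff μ ⟨x.1, c.image_mono h x.2⟩ := by
  rw [coord_res_eq]
  rfl

theorem symm_mem {U : Opens M} {x : EuclideanSpace ℝ (Fin p)} (hx : x ∈ c.image U) :
    c.chart.symm x ∈ U := hx.2

end Superchart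

end RingedSpace

namespace Supermanifold

open RingedSpace

variable {n q p : ℕ} {σ : Fin q → {g : Fin n → ZMod 2 // g ≠ 0}} {M : TopCat.{u}} [T2Space M]
  [SecondCountableTopology M] (A : Supermanifold p σ M)

/-- The supercharts of `A`, with the degrees of the formal variables read in `ℤ₂ⁿ`. -/
abbrev Chart : Type u := A.toRingedSpace.Superchart p (fun a => (σ a : Fin n → ZMod 2))

/-! ### The base projection -/

/-- The value `ε_U(f)(m)` of the base projection, as a ring morphism in `f`. It is read off in an
arbitrary chart around `m`. -/
def base {U : Opens M} (m : U) : A.Sections U →+* ℝ :=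
  (A.exists_superchart m.1).choose.value (A.exists_superchart m.1).choose_spec m.2

theorem ringHom_algebraMap {R : Type*} [Ring R] [Algebra ℝ R] (φ : R →+* ℝ) (r : ℝ) :
    φ (algebraMap ℝ R r) = r :=
  RingHom.congr_fun (Subsingleton.elim (φ.comp (algebraMap ℝ R)) (RingHom.id ℝ)) r

theorem base_eq_value (c : A.Chart) {U : Opens M} (m : U) (hm : m.1 ∈ c.chart.source)
    (f : A.Sections U) : A.base m f = c.value hm m.2 f := by
  have h : A.IsBaseValue (f - algebraMap ℝ (A.Sections U) (c.value hm m.2 f)) m.1 0 := by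
    rw [c.isBaseValue_zero_iff hm m.2, map_sub, ringHom_algebraMap, sub_self]
  rw [Superchart.isBaseValue_zero_iff _ (A.exists_superchart m.1).choose_spec m.2, map_sub,
    ringHom_algebraMap, sub_eq_zero] at h
  exact h

theorem base_eq_coeff (c : A.Chart) {U : Opens M} (m : U) (hm : m.1 ∈ c.chart.source)
    (f : A.Sections U) :
    A.base m f = (c.coord le_rfl f).coeff 0 ⟨c.chart m, c.mem_image hm m.2⟩ :=
  A.base_eq_value c m hm f

theorem coeff_zero_eq_base (c : A.Chart) {U : Opens M} (x : c.image U) (f : A.Sections U) :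
    (c.coord le_rfl f).coeff 0 x = A.base ⟨c.chart.symm x, c.symm_mem x.2⟩ f := by
  have hm : c.chart.symm x ∈ c.chart.source := c.chart.map_target x.2.1
  rw [A.base_eq_coeff c _ hm]
  congr
  exact Subtype.ext (c.chart.right_inv x.2.1).symm

theorem base_smul {U : Opens M} (m : U) (r : ℝ) (f : A.Sections U) :
    A.base m (r • f) = r * A.base m f := by
  rw [Algebra.smul_def, map_mul, ringHom_algebraMap]

theorem base_res {U V : Opens M} (h : V ≤ U) (m : V) (f : A.Sections U) :
    A.base m (A.res h f) = A.base ⟨m.1, h m.2⟩ f := by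
  obtain ⟨c, hc⟩ := A.exists_superchart m.1
  rw [A.base_eq_value c m hc, c.value_res]
  exact (A.base_eq_value c ⟨m.1, h m.2⟩ hc f).symm

theorem mem_J_iff {U : Opens M} {f : A.Sections U} : f ∈ A.J U ↔ ∀ m : U, A.base m f = 0 := by
  refine ⟨fun h m => ?_, fun h m hm => ?_⟩ <;> obtain ⟨c, hc⟩ := A.exists_superchart m
  · rw [A.base_eq_value c m hc]
    exact (c.isBaseValue_zero_iff hc m.2 f).1 (h m.1 m.2)
  · rw [c.isBaseValue_zero_iff hc hm, ← A.base_eq_value c ⟨m, hm⟩ hc, h]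

theorem continuous_base {U : Opens M} (f : A.Sections U) :
    Continuous fun m : U => A.base m f := by
  refine continuous_iff_continuousAt.2 fun m => ?_
  obtain ⟨c, hc⟩ := A.exists_superchart m.1
  let s : Set U := {m | m.1 ∈ c.chart.source}
  have hs : IsOpen s := c.chart.open_source.preimage continuous_subtype_val
  suffices ContinuousOn (fun m : U => A.base m f) s from this.continuousAt (hs.mem_nhds hc)
  rw [continuousOn_iff_continuous_domRestrict]
  have h1 : Continuous fun m : s => (⟨c.chart m.1.1, c.mem_image m.2 m.1.2⟩ : c.image U) := by
    refine Continuous.subtype_mk ?_ _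
    exact c.chart.continuousOn.comp_continuous
      (continuous_subtype_val.comp continuous_subtype_val) fun m => m.2
  refine ((((c.coord le_rfl f).coeff 0).contMDiff.continuous).comp h1).congr fun m => ?_
  exact (A.base_eq_coeff c m.1 m.2 f).symm

theorem isUnit_of_base_ne_zero {U : Opens M} {f : A.Sections U} (h : ∀ m, A.base m f ≠ 0) :
    IsUnit f := by
  refine A.isUnit_of_locally fun m hm => ?_
  obtain ⟨c, hc⟩ := A.exists_superchart m
  have h1 : ¬ A.IsBaseValue f m 0 := by
    rw [c.isBaseValue_zero_iff hc hm, ← A.base_eq_value c ⟨m, hm⟩ hc]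
    exact h _
  simp only [IsBaseValue, map_zero, sub_zero, not_forall, not_not] at h1
  obtain ⟨V, hV, hmV, hu⟩ := h1
  exact ⟨V, hV, hmV, hu⟩

/-! ### The order filtration on sections -/

/-- The left ideal of the sections whose coordinate forms are all of order at least `k`. -/
def orderIdeal (k : ℕ) (U : Opens M) : Ideal (A.Sections U) :=
  ⨅ c : A.Chart, (FormalSeries.orderIdeal _ _ k).comap (c.coord (le_refl (c.image U)))

theorem mem_orderIdeal {k : ℕ} {U : Opens M} {f : A.Sections U} : f ∈ A.orderIdeal k U ↔
    ∀ (c : A.Chart) (μ : Fin q →₀ ℕ), μ.degree < k →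
      (c.coord (le_refl (c.image U)) f).coeff μ = 0 := by
  simp only [orderIdeal, Ideal.mem_iInf, Ideal.mem_comap, FormalSeries.mem_orderIdeal]

theorem mul_mem_orderIdeal {j k : ℕ} {U : Opens M} {f g : A.Sections U}
    (hf : f ∈ A.orderIdeal j U) (hg : g ∈ A.orderIdeal k U) : f * g ∈ A.orderIdeal (j + k) U := by
  rw [mem_orderIdeal] at hf hg ⊢
  intro c
  rw [map_mul]
  exact FormalSeries.mul_mem_orderIdeal (hf c) (hg c)

theorem res_mem_orderIdeal {k : ℕ} {U V : Opens M} (h : V ≤ U) {f : A.Sections U}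
    (hf : f ∈ A.orderIdeal k U) : A.res h f ∈ A.orderIdeal k V := by
  rw [mem_orderIdeal] at hf ⊢
  intro c μ hμ
  ext x
  rw [c.coeff_coord_res, hf c μ hμ]
  rfl

theorem mem_orderIdeal_of_locally {k : ℕ} {U : Opens M} {f : A.Sections U}
    (h : ∀ m ∈ U, ∃ (V : Opens M) (hV : V ≤ U), m ∈ V ∧ A.res hV f ∈ A.orderIdeal k V) :
    f ∈ A.orderIdeal k U := by
  rw [mem_orderIdeal]
  intro c μ hμ
  ext x
  obtain ⟨V, hV, hmV, hf⟩ := h _ (c.symm_mem x.2)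
  have hx : x.1 ∈ c.image V := ⟨x.2.1, hmV⟩
  have h1 := c.coeff_coord_res hV f μ ⟨x.1, hx⟩
  rw [A.mem_orderIdeal.1 hf c μ hμ] at h1
  exact h1.symm

theorem J_eq_orderIdeal (U : Opens M) : A.J U = A.orderIdeal 1 U := by
  ext f
  rw [mem_J_iff, mem_orderIdeal]
  constructor
  · intro h c
    refine FormalSeries.mem_orderIdeal_one.2 ?_
    ext x
    rw [A.coeff_zero_eq_base, h]
    rfl
  · intro h m
    obtain ⟨c, hc⟩ := A.exists_superchart m.1
    rw [A.base_eq_coeff c m hc, FormalSeries.mem_orderIdeal_one.1 (h c)]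
    rfl

theorem J_pow_le_orderIdeal (k : ℕ) (U : Opens M) : A.J U ^ k ≤ A.orderIdeal k U := by
  induction k with
  | zero => exact fun f _ => A.mem_orderIdeal.2 fun c μ hμ => absurd hμ (Nat.not_lt_zero _)
  | succ k ih =>
    rw [Submodule.pow_succ, Ideal.mul_le]
    exact fun r hr s hs => A.mul_mem_orderIdeal (ih hr) (A.J_eq_orderIdeal U ▸ hs)

/-- In the domain of a chart, a section of order `k + 1` there is a combination, with
coefficients of order `k`, of the `q` formal variables. -/
theorem exists_eq_sum_of_coord (c : A.Chart) {U : Opens M} (hU : (U : Set M) ⊆ c.chart.source)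
    {k : ℕ} {f : A.Sections U} (hf : c.coord le_rfl f ∈ FormalSeries.orderIdeal _ _ (k + 1)) :
    ∃ x g : Fin q → A.Sections U, (∀ a, x a ∈ A.J U) ∧
      (∀ a, c.coord le_rfl (g a) ∈ FormalSeries.orderIdeal _ _ k) ∧ f = ∑ a, x a * g a := by
  choose x hx using fun a => (c.coord_bijective hU).2 (FormalSeries.X _ _ a)
  choose g hg using fun a =>
    (c.coord_bijective hU).2 (FormalSeries.leftQuotient a (c.coord le_rfl f))
  refine ⟨x, g, fun a => A.mem_J_iff.2 fun m => ?_, fun a => ?_, ?_⟩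
  · rw [A.base_eq_coeff c m (hU m.2), hx, FormalSeries.coeff_X_zero]
    rfl
  · rw [hg]
    exact FormalSeries.leftQuotient_mem hf a
  · apply (c.coord_bijective hU).1
    rw [map_sum, FormalSeries.eq_sum_X_mul (hf 0 (by simp))]
    refine Finset.sum_congr rfl fun a _ => ?_
    rw [map_mul, hx, hg]

theorem mem_J_pow_of_coord (c : A.Chart) {U : Opens M} (hU : (U : Set M) ⊆ c.chart.source)
    {k : ℕ} {f : A.Sections U} (hf : c.coord le_rfl f ∈ FormalSeries.orderIdeal _ _ k) :
    f ∈ A.J U ^ k := by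
  induction k generalizing f with
  | zero => simp [Submodule.pow_zero, Ideal.one_eq_top]
  | succ k ih =>
    obtain ⟨x, g, hx, hg, rfl⟩ := A.exists_eq_sum_of_coord c hU hf
    rw [Ideal.IsTwoSided.pow_succ]
    exact Submodule.sum_mem _ fun a _ => Ideal.mul_mem_mul (hx a) (ih (hg a))

/-- Whether a section is of order at least `k` can be checked in a single chart. -/
theorem mem_orderIdeal_of_coord (c : A.Chart) {U : Opens M}
    (hU : (U : Set M) ⊆ c.chart.source) {k : ℕ} {f : A.Sections U}
    (hf : c.coord le_rfl f ∈ FormalSeries.orderIdeal _ _ k) : f ∈ A.orderIdeal k U :=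
  A.J_pow_le_orderIdeal k U (A.mem_J_pow_of_coord c hU hf)

theorem eq_zero_of_forall_mem_orderIdeal {U : Opens M} {f : A.Sections U}
    (h : ∀ k, f ∈ A.orderIdeal k U) : f = 0 := by
  refine A.ext_of_locally fun m hm => ?_
  obtain ⟨c, hc⟩ := A.exists_superchart m
  let V : Opens M := ⟨c.chart.source, c.chart.open_source⟩ ⊓ U
  refine ⟨V, inf_le_right, ⟨hc, hm⟩, ?_⟩
  apply (c.coord_bijective (U := V) fun x hx => hx.1).1
  rw [map_zero, map_zero]
  refine FormalSeries.ext fun μ => ?_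
  exact A.mem_orderIdeal.1 (A.res_mem_orderIdeal inf_le_right (h (μ.degree + 1))) c μ
    (Nat.lt_succ_self _)

/-! ### Cutoff sections -/

theorem locallyCompactSpace (A : Supermanifold p σ M) : LocallyCompactSpace M := by
  let : ChartedSpace (EuclideanSpace ℝ (Fin p)) M :=
    { atlas := Set.range fun c : A.Chart => c.chart
      chartAt := fun m => (A.exists_superchart m).choose.chart
      mem_chart_source := fun m => (A.exists_superchart m).choose_spec
      chart_mem_atlas := fun m => ⟨_, rfl⟩ }
  exact ChartedSpace.locallyCompactSpace (EuclideanSpace ℝ (Fin p)) M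

theorem regularSpace (A : Supermanifold p σ M) : RegularSpace M :=
  have := A.locallyCompactSpace
  inferInstance

theorem exists_chart_cutoff (c : A.Chart) {W : Opens M} (hW : (W : Set M) ⊆ c.chart.source)
    (O : Opens M) : ∃ η : A.Sections W, A.IsCentral η ∧ (∀ m, 0 ≤ A.base m η) ∧
      (∀ m : W, m.1 ∈ O → 0 < A.base m η) ∧
      ∀ (V : Opens M) (hV : V ≤ W), Disjoint V O → A.res hV η = 0 := by
  obtain ⟨φ, hφ, hφs, hφr⟩ := IsOpen.exists_contDiff_support_eq (n := ⊤) (c.image O).isOpen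
  have hpos : ∀ x, 0 ≤ φ x := fun x => (hφr ⟨x, rfl⟩).1
  let F : SmoothFunctions (c.image W) :=
    ⟨fun x => φ x.1, hφs.contMDiff.comp contMDiff_subtype_val⟩
  obtain ⟨η, hη⟩ := (c.coord_bijective hW).2 (FormalSeries.const F)
  have hres : ∀ (V : Opens M) (hV : V ≤ W), c.coord le_rfl (A.res hV η) =
      FormalSeries.const (SmoothFunctions.restrict (c.image_mono hV) F) := fun V hV => by
    rw [c.coord_res_eq, hη]
    exact FormalSeries.map_const _ _
  have hbase : ∀ m : W, A.base m η = φ (c.chart m.1) := fun m => by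
    rw [A.base_eq_coeff c m (hW m.2), hη, FormalSeries.coeff_const, if_pos rfl]
    rfl
  refine ⟨η, fun V hV g => ?_, fun m => ?_, fun m hm => ?_, fun V hV hd => ?_⟩
  · apply (c.coord_bijective (U := V) fun x hx => hW (hV hx)).1
    rw [map_mul, map_mul, hres]
    exact FormalSeries.const_commute _ _
  · rw [hbase]
    exact hpos _
  · rw [hbase]
    refine lt_of_le_of_ne (hpos _) (Ne.symm ?_)
    rw [← Function.mem_support, hφ]
    exact c.mem_image (hW m.2) hm
  · apply (c.coord_bijective (U := V) fun x hx => hW (hV hx)).1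
    rw [hres, map_zero]
    have h0 : SmoothFunctions.restrict (c.image_mono hV) F = 0 := by
      ext x
      by_contra hne
      have hx : x.1 ∈ Function.support φ := hne
      rw [hφ] at hx
      exact (Opens.coe_disjoint.2 hd).le_bot ⟨x.2.2, hx.2⟩
    refine FormalSeries.ext fun μ => ?_
    rw [h0, FormalSeries.coeff_const, ite_self, FormalSeries.coeff_zero]

/-- `η ∈ A(U)` is a cutoff for `W ⊆ U`: it is central, its base projection is non-negative, and it
vanishes on an open set `V` that covers `U` together with `W`. -/
structure IsCutoff {U : Opens M} (W V : Opens M) (η : A.Sections U) : Prop where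
  le : W ≤ U
  le' : V ≤ U
  cover : U ≤ W ⊔ V
  central : A.IsCentral η
  nonneg (m : U) : 0 ≤ A.base m η
  res_eq_zero : A.res le' η = 0

theorem exists_cutoff {ι : Type*} {U : Opens M} (W : ι → Opens M) (hWU : ∀ i, W i ≤ U)
    (hd : Pairwise fun i j => Disjoint (W i) (W j))
    (hW : ∀ i, ∃ c : A.Chart, (W i : Set M) ⊆ c.chart.source) (O : Opens M)
    (hO : ∀ m ∈ U, m ∈ closure (O : Set M) → m ∈ iSup W) :
    ∃ (V : Opens M) (η : A.Sections U), A.IsCutoff (iSup W) V η ∧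
      ∀ m : U, m.1 ∈ O → 0 < A.base m η := by
  choose c hc using hW
  choose η hη hη0 hηO hηd using fun i => A.exists_chart_cutoff (c i) (hc i) O
  have hle : ∀ i, W i ≤ iSup W := le_iSup W
  have hWU' : iSup W ≤ U := iSup_le hWU
  obtain ⟨θ, hθ⟩ := A.exists_glue_of_disjoint W hle le_rfl hd η
  let V : Opens M := U ⊓ ⟨(closure (O : Set M))ᶜ, isClosed_closure.isOpen_compl⟩
  have hVU : V ≤ U := inf_le_left
  have hcov : U ≤ iSup W ⊔ V := fun m hm => by
    by_cases h : m ∈ closure (O : Set M)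
    · exact Or.inl (hO m hm h)
    · exact Or.inr ⟨hm, h⟩
  have hVO : Disjoint V O := by
    rw [← Opens.coe_disjoint]
    exact Set.disjoint_left.2 fun m hm hmO => hm.2 (subset_closure hmO)
  obtain ⟨f, hf, hf0⟩ := A.exists_extend hWU' hVU hcov θ (by
    refine A.ext_of_locally fun m hm => ?_
    obtain ⟨i, hi⟩ := Opens.mem_iSup.1 hm.1
    refine ⟨W i ⊓ V, inf_le_inf_right V (hle i), ⟨hi, hm.2⟩, ?_⟩
    rw [A.res_res, map_zero, ← hηd i (W i ⊓ V) inf_le_left (hVO.mono_left inf_le_right), ← hθ i,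
      A.res_res])
  have hfW : ∀ i, A.res (hWU i) f = η i := fun i => by
    rw [← hθ i, ← hf, A.res_res]
  have hbase : ∀ (m : U) (i) (hi : m.1 ∈ W i), A.base m f = A.base ⟨m.1, hi⟩ (η i) :=
    fun m i hi => by rw [← hfW i, A.base_res]
  refine ⟨V, f, ⟨hWU', hVU, hcov, A.isCentral_of_locally fun m hm => ?_, fun m => ?_, hf0⟩,
    fun m hm => ?_⟩
  · rcases hcov hm with h | h
    · obtain ⟨i, hi⟩ := Opens.mem_iSup.1 h
      exact ⟨W i, hWU i, hi, by rw [hfW]; exact hη i⟩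
    · exact ⟨V, hVU, h, by rw [hf0]; exact A.isCentral_zero⟩
  · rcases hcov m.2 with h | h
    · obtain ⟨i, hi⟩ := Opens.mem_iSup.1 h
      rw [hbase m i hi]
      exact hη0 i _
    · have := A.base_res hVU ⟨m.1, h⟩ f
      rw [hf0, map_zero] at this
      exact this.le
  · obtain ⟨i, hi⟩ := Opens.mem_iSup.1 (hO m.1 m.2 (subset_closure hm))
    rw [hbase m i hi]
    exact hηO i ⟨m.1, hi⟩ hm

/-- The product with a cutoff for `W` extends sections over `W` by zero. -/
theorem IsCutoff.exists_mul_extend {A : Supermanifold p σ M} {U W V : Opens M}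
    {η : A.Sections U} (h : A.IsCutoff W V η) (s : A.Sections W) :
    ∃ f : A.Sections U, A.res h.le f = A.res h.le η * s ∧ A.res h.le' f = 0 ∧
      ∀ k, s ∈ A.orderIdeal k W → f ∈ A.orderIdeal k U := by
  obtain ⟨f, hf, hf0⟩ := A.exists_extend h.le h.le' h.cover (A.res h.le η * s) (by
    rw [map_mul, A.res_res, ← A.res_res h.le' inf_le_right, h.res_eq_zero, map_zero, zero_mul])
  refine ⟨f, hf, hf0, fun k hs => A.mem_orderIdeal_of_locally fun m hm => ?_⟩
  rcases h.cover hm with hm | hm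
  · exact ⟨W, h.le, hm, by rw [hf]; exact Ideal.mul_mem_left _ _ hs⟩
  · exact ⟨V, h.le', hm, by rw [hf0]; exact zero_mem _⟩

theorem IsCutoff.ext {A : Supermanifold p σ M} {U W V : Opens M}
    {η : A.Sections U} (h : A.IsCutoff W V η) {f g : A.Sections U}
    (h1 : A.res h.le f = A.res h.le g) (h2 : A.res h.le' f = A.res h.le' g) : f = g := by
  refine A.ext_of_locally fun m hm => ?_
  rcases h.cover hm with hm | hm
  · exact ⟨W, h.le, hm, h1⟩
  · exact ⟨V, h.le', hm, h2⟩

/-- Cutoffs for a finite cover of `U` by disjoint unions of chart domains, without common zero of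
the base projections. -/
theorem exists_cutoffs {κ ι : Type*} [Finite κ] {U : Opens M} (W : κ → ι → Opens M)
    (hWU : ∀ k i, W k i ≤ U) (hU : U ≤ ⨆ k, iSup (W k))
    (hd : ∀ k, Pairwise fun i j => Disjoint (W k i) (W k j))
    (hW : ∀ k i, ∃ c : A.Chart, (W k i : Set M) ⊆ c.chart.source) :
    ∃ (V : κ → Opens M) (η : κ → A.Sections U), (∀ k, A.IsCutoff (iSup (W k)) (V k) (η k)) ∧
      ∀ m : U, ∃ k, 0 < A.base m (η k) := by
  have := A.regularSpace
  have : SecondCountableTopology U := inferInstanceAs (SecondCountableTopology (U : Set M))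
  have : RegularSpace U := inferInstanceAs (RegularSpace (U : Set M))
  have : NormalSpace U := inferInstance
  obtain ⟨v, hv, hvo, hvW⟩ := exists_iUnion_eq_closure_subset (X := U)
    (u := fun k => {m | m.1 ∈ iSup (W k)})
    (fun k => (iSup (W k)).isOpen.preimage continuous_subtype_val) (fun x => Set.toFinite _)
    (by
      refine Set.eq_univ_of_forall fun m => ?_
      obtain ⟨k, hk⟩ := Opens.mem_iSup.1 (hU m.2)
      exact Set.mem_iUnion.2 ⟨k, hk⟩)
  let O : κ → Opens M := fun k =>
    ⟨Subtype.val '' v k, U.isOpen.isOpenMap_subtype_val _ (hvo k)⟩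
  choose V η hη hpos using fun k => A.exists_cutoff (W k) (hWU k) (hd k) (hW k) (O k)
    fun m hm hmO => hvW k (show (⟨m, hm⟩ : U) ∈ closure (v k) from closure_subtype.2 hmO)
  refine ⟨V, η, hη, fun m => ?_⟩
  obtain ⟨k, hk⟩ := Set.mem_iUnion.1 (hv.symm ▸ Set.mem_univ m)
  exact ⟨k, hpos k m ⟨m, hk, rfl⟩⟩

/-- Around every point of an open set `U` there is a section over `U` whose base projection is
greater than `1` at the point and is zero outside a given neighbourhood of it. -/
theorem exists_bump (c : A.Chart) {U W : Opens M} (hWU : W ≤ U)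
    (hW : (W : Set M) ⊆ c.chart.source) {m : M} (hm : m ∈ W) :
    ∃ f : A.Sections U, 1 < A.base ⟨m, hWU hm⟩ f ∧ ∀ x : U, 0 < A.base x f → x.1 ∈ W := by
  have := A.regularSpace
  obtain ⟨s, hs, hsc, hsW⟩ := exists_mem_nhds_isClosed_subset (W.isOpen.mem_nhds hm)
  have hcl : closure (interior s) ⊆ W := (hsc.closure_interior_subset).trans hsW
  obtain ⟨V, η, hη, hpos⟩ := A.exists_cutoff (fun _ : Unit => W) (fun _ => hWU)
    (fun i j hij => absurd (Subsingleton.elim i j) hij) (fun _ => ⟨c, hW⟩) ⟨_, isOpen_interior⟩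
    (fun x _ hx => Opens.mem_iSup.2 ⟨(), hcl hx⟩)
  have hη1 := hpos ⟨m, hWU hm⟩ (mem_interior_iff_mem_nhds.2 hs)
  refine ⟨(2 / A.base ⟨m, hWU hm⟩ η) • η, ?_, fun x hx => ?_⟩
  · rw [base_smul, div_mul_cancel₀ _ hη1.ne']
    exact one_lt_two
  · rcases hη.cover x.2 with h | h
    · obtain ⟨_, h⟩ := Opens.mem_iSup.1 h
      exact h
    · have h2 := A.base_res hη.le' ⟨x.1, h⟩ η
      rw [hη.res_eq_zero, map_zero] at h2
      rw [base_smul, ← h2, mul_zero] at hx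
      exact absurd hx (lt_irrefl _)

end Supermanifold

/-! ### Covers by finitely many disjoint families -/

/-- If at most `N` of the continuous functions `u 0, u 1, …` vanish at any given point, and one of
them is positive there, then the sets `{u m > 0}` have an open refinement that consists of `N + 1`
families of pairwise disjoint sets. -/
theorem exists_disjoint_families {X : Type*} [TopologicalSpace X] {N : ℕ} {u : ℕ → X → ℝ}
    (hu : ∀ i, Continuous (u i)) (hpos : ∀ x, ∃ i, 0 < u i x)
    (hN : ∀ x (I : Finset ℕ), (∀ i ∈ I, u i x = 0) → I.card ≤ N) :
    ∃ W : Fin (N + 1) → ℕ × Finset ℕ → Set X, (∀ k i, IsOpen (W k i)) ∧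
      (∀ k, Pairwise fun i j => Disjoint (W k i) (W k j)) ∧ (∀ x, ∃ k i, x ∈ W k i) ∧
      ∀ k i, W k i ⊆ {x | 0 < u i.1 x} := by
  classical
  -- `(m, I)` is attributed to `x` if `m` is the first index with `u m x > 0`, and `I` consists of
  -- the indices `i < m` with `u i x = 0`; the inequalities below hold in a neighbourhood of `x`.
  refine ⟨fun k i => {x | (↑i.2 ⊆ Set.Iio i.1 ∧ i.2.card = k) ∧ 0 < u i.1 x ∧
    (∀ l < i.1, l ∉ i.2 → u l x < 0) ∧ ∀ j ∈ i.2, ∀ l ≤ i.1, l ∉ i.2 → |u j x| < |u l x|},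
    ?_, ?_, ?_, fun k i x hx => hx.2.1⟩
  · rintro k ⟨m, I⟩
    refine isOpen_const.and ((isOpen_lt continuous_const (hu m)).and (IsOpen.and ?_ ?_))
    · simp only [Set.ofPred_forall]
      refine (Set.finite_Iio m).isOpen_biInter fun l _ => isOpen_iInter_of_finite fun _ => ?_
      exact isOpen_lt (hu l) continuous_const
    · simp only [Set.ofPred_forall]
      refine I.finite_toSet.isOpen_biInter fun j _ =>
        (Set.finite_Iic m).isOpen_biInter fun l _ => isOpen_iInter_of_finite fun _ => ?_
      exact isOpen_lt (hu j).abs (hu l).abs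
  · rintro k ⟨m, I⟩ ⟨m', I'⟩ hne
    refine Set.disjoint_left.2 ?_
    have key : ∀ (m m' : ℕ) (I I' : Finset ℕ), m ≤ m' → (m, I) ≠ (m', I') → ∀ x,
        ((↑I ⊆ Set.Iio m ∧ I.card = k) ∧ 0 < u m x ∧ (∀ l < m, l ∉ I → u l x < 0) ∧
          ∀ j ∈ I, ∀ l ≤ m, l ∉ I → |u j x| < |u l x|) →
        ((↑I' ⊆ Set.Iio m' ∧ I'.card = k) ∧ 0 < u m' x ∧ (∀ l < m', l ∉ I' → u l x < 0) ∧
          ∀ j ∈ I', ∀ l ≤ m', l ∉ I' → |u j x| < |u l x|) → False := by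
      rintro m m' I I' hmm hne x ⟨⟨h1, h2⟩, h3, h4, h5⟩ ⟨⟨h1', h2'⟩, h3', h4', h5'⟩
      -- there is `l ∈ I' \ I` with `l ≤ m`; comparing with `j ∈ I \ I'` gives a contradiction
      obtain ⟨l, hl, hlI, hlm⟩ : ∃ l ∈ I', l ∉ I ∧ l ≤ m := by
        rcases hmm.eq_or_lt with rfl | hlt
        · have hII : I ≠ I' := fun h => hne (by rw [h])
          have : ¬ I' ⊆ I := fun h => hII (Finset.eq_of_subset_of_card_le h (by omega)).symm
          obtain ⟨l, hl, hlI⟩ := Finset.not_subset.1 this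
          exact ⟨l, hl, hlI, le_of_lt (h1' hl)⟩
        · refine ⟨m, ?_, fun h => lt_irrefl m (h1 h), le_rfl⟩
          by_contra h
          exact absurd (h4' m hlt h) (not_lt.2 h3.le)
      obtain ⟨j, hj, hjI⟩ : ∃ j ∈ I, j ∉ I' := by
        refine Finset.not_subset.1 fun h => hlI ?_
        rwa [Finset.eq_of_subset_of_card_le h (by omega)]
      exact lt_asymm (h5 j hj l hlm hlI) (h5' l hl j ((le_of_lt (h1 hj)).trans hmm) hjI)
    intro x hx hx'
    rcases le_total m m' with h | h
    · exact key m m' I I' h hne x hx hx'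
    · exact key m' m I' I h hne.symm x hx' hx
  · intro x
    have hm := Nat.find_spec (hpos x)
    have hmin : ∀ l < Nat.find (hpos x), u l x ≤ 0 := fun l hl =>
      not_lt.1 (Nat.find_min (hpos x) hl)
    set m := Nat.find (hpos x)
    set I := (Finset.range m).filter fun l => u l x = 0 with hI
    have hIlt : ∀ l ∈ I, l < m := fun l hl => Finset.mem_range.1 (Finset.mem_filter.1 hl).1
    have hI0 : ∀ l ∈ I, u l x = 0 := fun l hl => (Finset.mem_filter.1 hl).2
    have hnI : ∀ l < m, l ∉ I → u l x ≠ 0 := fun l hl hlI h =>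
      hlI (Finset.mem_filter.2 ⟨Finset.mem_range.2 hl, h⟩)
    refine ⟨⟨I.card, Nat.lt_succ_of_le (hN x I hI0)⟩, (m, I), ⟨fun l hl => hIlt l hl, rfl⟩, hm,
      fun l hl hlI => lt_of_le_of_ne (hmin l hl) (hnI l hl hlI), fun j hj l hl hlI => ?_⟩
    rw [hI0 j hj, abs_zero, abs_pos]
    rcases (show l ≤ m from hl).eq_or_lt with rfl | hl
    · exact hm.ne'
    · exact hnI l hl hlI

/-- Generic thresholds: by Baire's theorem, if the image under any `N + 1` of the functions `g i`
of each of countably many sets covering `X` is closed with empty interior, then for suitable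
`t i ∈ (0, 1)` no `N + 1` of the equations `g i x = t i` have a common solution. -/
theorem exists_thresholds {X κ : Type*} [Countable κ] {N : ℕ} (g : ℕ → X → ℝ) (K : κ → Set X)
    (hK : ∀ x, ∃ k, x ∈ K k)
    (h : ∀ k (I : Finset ℕ), I.card = N + 1 → IsClosed ((fun x (i : I) => g i x) '' K k) ∧
      Dense ((fun x (i : I) => g i x) '' K k)ᶜ) :
    ∃ t : ℕ → ℝ, (∀ i, 0 < t i ∧ t i < 1) ∧
      ∀ x (I : Finset ℕ), (∀ i ∈ I, g i x = t i) → I.card ≤ N := by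
  have : PolishSpace (Set.Ioo (0 : ℝ) 1) := isOpen_Ioo.polishSpace
  let ρ : (I : Finset ℕ) → (ℕ → Set.Ioo (0 : ℝ) 1) → I → ℝ := fun I t i => (t i).1
  have hρc : ∀ I, Continuous (ρ I) := fun I =>
    continuous_pi fun i => continuous_subtype_val.comp (continuous_apply _)
  have hρo : ∀ I, IsOpenMap (ρ I) := fun I => by
    have h1 : IsOpenMap fun (t : ℕ → Set.Ioo (0 : ℝ) 1) (i : I) => t i :=
      isOpenMap_fst.comp
        (Homeomorph.piEquivPiSubtypeProd (· ∈ I) fun _ => Set.Ioo (0 : ℝ) 1).isOpenMap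
    have h2 : IsOpenMap (Pi.map fun (_ : I) (t : Set.Ioo (0 : ℝ) 1) => t.1) :=
      IsOpenMap.piMap (fun _ => isOpen_Ioo.isOpenMap_subtype_val)
        (Set.toFinite _)
    exact h2.comp h1
  have hd : Dense (⋂ i : κ × {I : Finset ℕ // I.card = N + 1},
      ρ i.2.1 ⁻¹' ((fun x (j : i.2.1) => g j x) '' K i.1)ᶜ) :=
    dense_iInter_of_isOpen
      (fun i => (h i.1 i.2.1 i.2.2).1.isOpen_compl.preimage (hρc _))
      fun i => (h i.1 i.2.1 i.2.2).2.preimage (hρo _)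
  have : Nonempty (ℕ → Set.Ioo (0 : ℝ) 1) := ⟨fun _ => ⟨1 / 2, by norm_num, by norm_num⟩⟩
  obtain ⟨t, ht⟩ := hd.nonempty
  refine ⟨fun i => (t i).1, fun i => (t i).2, fun x I hI => ?_⟩
  by_contra hcard
  obtain ⟨I', hI', hc⟩ := Finset.exists_subset_card_eq (show N + 1 ≤ I.card by omega)
  obtain ⟨k, hk⟩ := hK x
  exact Set.mem_iInter.1 ht (k, ⟨I', hc⟩) ⟨x, hk, funext fun i => hI i (hI' i.2)⟩

namespace Supermanifold

open RingedSpace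

variable {n q p : ℕ} {σ : Fin q → {g : Fin n → ZMod 2 // g ≠ 0}} {M : TopCat.{u}} [T2Space M]
  [SecondCountableTopology M] (A : Supermanifold p σ M)

/-- The base projections of more than `p` sections map a compact ball of a chart onto a closed set
with empty interior: they are smooth in the coordinates, so cannot raise the dimension. -/
theorem dense_compl_image_base (c : A.Chart) {U : Opens M} {ι : Type*} [Fintype ι]
    (hι : p < Fintype.card ι) (f : ι → A.Sections U) {y : EuclideanSpace ℝ (Fin p)} {r : ℝ}
    (hr : Metric.closedBall y r ⊆ c.image U) :
    IsClosed ((fun (m : U) (i : ι) => A.base m (f i)) ''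
      {m | m.1 ∈ c.chart.source ∧ c.chart m.1 ∈ Metric.closedBall y r}) ∧
    Dense ((fun (m : U) (i : ι) => A.base m (f i)) ''
      {m | m.1 ∈ c.chart.source ∧ c.chart m.1 ∈ Metric.closedBall y r})ᶜ := by
  classical
  -- the base projections in coordinates; the value `0` off `c.image U` plays no role
  let G : EuclideanSpace ℝ (Fin p) → ι → ℝ := fun x i =>
    if h : x ∈ c.image U then (c.coord le_rfl (f i)).coeff 0 ⟨x, h⟩ else 0
  have hG : ContDiffOn ℝ 1 G (Metric.closedBall y r) := by
    refine contDiffOn_pi.2 fun i x hx => ContDiffAt.contDiffWithinAt ?_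
    have h1 := ((c.coord le_rfl (f i)).coeff 0).contMDiff ⟨x, hr hx⟩
    have h2 : ContMDiffAt 𝓘(ℝ, EuclideanSpace ℝ (Fin p)) 𝓘(ℝ, ℝ) ∞
        (fun z : c.image U => (fun x => G x i) z) ⟨x, hr hx⟩ := by
      refine h1.congr_of_eventuallyEq (Filter.Eventually.of_forall fun z => ?_)
      exact dif_pos z.2
    have h3 := (contMDiffAt_subtype_iff (U := c.image U) (f := fun z => G z i)
      (x := ⟨x, hr hx⟩)).1 h2
    exact h3.contDiffAt.of_le (mod_cast le_top)
  have himage : (fun (m : U) (i : ι) => A.base m (f i)) ''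
      {m | m.1 ∈ c.chart.source ∧ c.chart m.1 ∈ Metric.closedBall y r} =
      G '' Metric.closedBall y r := by
    ext z
    constructor
    · rintro ⟨m, ⟨hm, hmy⟩, rfl⟩
      refine ⟨c.chart m, hmy, funext fun i => ?_⟩
      exact (dif_pos (hr hmy)).trans (A.base_eq_coeff c m hm (f i)).symm
    · rintro ⟨x, hx, rfl⟩
      have hx' := hr hx
      refine ⟨⟨c.chart.symm x, c.symm_mem hx'⟩, ⟨c.chart.map_target hx'.1, ?_⟩,
        funext fun i => ?_⟩
      · rwa [c.chart.right_inv hx'.1]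
      · refine (A.coeff_zero_eq_base c ⟨x, hx'⟩ (f i)).symm.trans ?_
        have h : G x i = (c.coord le_rfl (f i)).coeff 0 ⟨x, hx'⟩ := dif_pos hx'
        exact h.symm
  rw [himage]
  refine ⟨((isCompact_closedBall y r).image_of_continuousOn hG.continuousOn).isClosed,
    hG.dense_compl_image_of_dimH_lt_finrank (convex_closedBall y r) subset_rfl ?_⟩
  refine (dimH_mono (Set.subset_univ _)).trans_lt ?_
  rw [Real.dimH_univ_eq_finrank, finrank_euclideanSpace_fin, Module.finrank_fintype_fun_eq_card]
  exact_mod_cast hι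

/-- Covering dimension at most `p`: if `U` is covered by open sets with a property that is
inherited by open subsets, it is covered by `p + 1` families of pairwise disjoint open sets with
this property. -/
theorem exists_colored_cover (A : Supermanifold p σ M) {U : Opens M} (P : Opens M → Prop)
    (hP : ∀ {V W : Opens M}, W ≤ V → P V → P W) (h : ∀ m ∈ U, ∃ V : Opens M, m ∈ V ∧ P V) :
    ∃ (ι : Type) (W : Fin (p + 1) → ι → Opens M), (∀ k i, W k i ≤ U) ∧ U ≤ ⨆ k, iSup (W k) ∧
      (∀ k, Pairwise fun i j => Disjoint (W k i) (W k j)) ∧ ∀ k i, P (W k i) := by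
  by_cases hU : Nonempty U
  swap
  · exact ⟨Empty, fun _ => Empty.elim, fun _ => by rintro ⟨⟩,
      fun m hm => absurd ⟨⟨m, hm⟩⟩ hU, fun _ => by rintro ⟨⟩, fun _ => by rintro ⟨⟩⟩
  have : SecondCountableTopology U := inferInstanceAs (SecondCountableTopology (U : Set M))
  -- countably many bumps with support in sets with the property `P`
  choose V hmV hPV using h
  choose c hc using A.exists_superchart
  let S : U → Opens M := fun m =>
    U ⊓ V m.1 m.2 ⊓ ⟨(c m.1).chart.source, (c m.1).chart.open_source⟩
  have hmS : ∀ m : U, m.1 ∈ S m := fun m => ⟨⟨m.2, hmV m.1 m.2⟩, hc m.1⟩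
  have hSU : ∀ m : U, S m ≤ U := fun m => inf_le_left.trans inf_le_left
  choose f hf1 hf0 using fun m : U =>
    A.exists_bump (c m.1) (hSU m) (fun x hx => hx.2) (hmS m)
  obtain ⟨s, hs, hsU⟩ := TopologicalSpace.countable_cover_nhds (f := fun m : U =>
    {x : U | 1 < A.base x (f m)}) fun m =>
      (isOpen_lt continuous_const (A.continuous_base (f m))).mem_nhds (hf1 m)
  have hsne : s.Nonempty := by
    obtain ⟨m⟩ := hU
    obtain ⟨x, hx, -⟩ := Set.mem_iUnion₂.1 (hsU.symm ▸ Set.mem_univ m)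
    exact ⟨x, hx⟩
  obtain ⟨e, rfl⟩ := hs.exists_eq_range hsne
  -- countably many balls of charts that cover `U`
  have hball : ∀ m : U, ∃ r > 0, Metric.closedBall ((c m.1).chart m.1) r ⊆ (c m.1).image U :=
    fun m => Metric.nhds_basis_closedBall.mem_iff.1
      (((c m.1).image U).isOpen.mem_nhds ((c m.1).mem_image (hc m.1) m.2))
  choose r hr hrU using hball
  let K : U → Set U := fun m => {x | x.1 ∈ (c m.1).chart.source ∧
    (c m.1).chart x.1 ∈ Metric.closedBall ((c m.1).chart m.1) (r m)}
  obtain ⟨s', hs', hsU'⟩ := TopologicalSpace.countable_cover_nhds (f := K) fun m => by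
    have h1 := (c m.1).chart.continuousAt (hc m.1)
    have h2 : (c m.1).chart.source ∩ (c m.1).chart ⁻¹'
        Metric.closedBall ((c m.1).chart m.1) (r m) ∈ nhds m.1 :=
      Filter.inter_mem ((c m.1).chart.open_source.mem_nhds (hc m.1))
        (h1 (Metric.closedBall_mem_nhds _ (hr m)))
    exact continuous_subtype_val.continuousAt h2
  have : Countable s' := hs'.to_subtype
  obtain ⟨t, ht, htN⟩ := exists_thresholds (N := p) (fun i (x : U) => A.base x (f (e i)))
    (fun m : s' => K m)
    (fun x => by
      obtain ⟨m, hm, hx⟩ := Set.mem_iUnion₂.1 (hsU'.symm ▸ Set.mem_univ x)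
      exact ⟨⟨m, hm⟩, hx⟩)
    fun m I hI => A.dense_compl_image_base (c m.1.1) (ι := I) (by simp [hI])
      (fun i => f (e i)) (hrU m.1)
  obtain ⟨W, hWo, hWd, hW, hWpos⟩ := exists_disjoint_families (N := p)
    (u := fun i (x : U) => A.base x (f (e i)) - t i)
    (fun i => (A.continuous_base _).sub continuous_const)
    (fun x => by
      obtain ⟨_, ⟨i, rfl⟩, hx⟩ := Set.mem_iUnion₂.1 (hsU.symm ▸ Set.mem_univ x)
      exact ⟨i, sub_pos.2 ((ht i).2.trans hx)⟩)
    (fun x I hI => htN x I fun i hi => sub_eq_zero.1 (hI i hi))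
  refine ⟨ℕ × Finset ℕ,
    fun k i => ⟨Subtype.val '' W k i, U.isOpen.isOpenMap_subtype_val _ (hWo k i)⟩, ?_, ?_, ?_, ?_⟩
  · rintro k i _ ⟨x, -, rfl⟩
    exact x.2
  · intro m hm
    obtain ⟨k, i, hi⟩ := hW ⟨m, hm⟩
    exact Opens.mem_iSup.2 ⟨k, Opens.mem_iSup.2 ⟨i, ⟨m, hm⟩, hi, rfl⟩⟩
  · intro k i j hij
    rw [← Opens.coe_disjoint]
    exact (Set.disjoint_image_iff Subtype.val_injective).2 (hWd k hij)
  · intro k i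
    refine hP ?_ (hPV (e i.1).1 (e i.1).2)
    rintro _ ⟨x, hx, rfl⟩
    exact (hf0 (e i.1) x ((ht i.1).1.trans (sub_pos.1 (hWpos k i hx)))).1.2

/-! ### The powers of `J` -/

/-- On a disjoint union of chart domains, a section of order `k + 1` is a combination of `q`
sections in `J`: the number of summands does not depend on the number of charts. -/
theorem exists_eq_sum_of_disjoint {ι : Type*} (W : ι → Opens M)
    (hd : Pairwise fun i j => Disjoint (W i) (W j))
    (hW : ∀ i, ∃ c : A.Chart, (W i : Set M) ⊆ c.chart.source) {k : ℕ}
    {f : A.Sections (iSup W)} (hf : f ∈ A.orderIdeal (k + 1) (iSup W)) :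
    ∃ x g : Fin q → A.Sections (iSup W), (∀ a, x a ∈ A.orderIdeal 1 (iSup W)) ∧
      (∀ a, g a ∈ A.orderIdeal k (iSup W)) ∧ f = ∑ a, x a * g a := by
  have hle : ∀ i, W i ≤ iSup W := le_iSup W
  have hmem : ∀ m ∈ iSup W, ∃ i, m ∈ W i := fun m hm => Opens.mem_iSup.1 hm
  choose c hc using hW
  choose x g hx hg hs using fun i => A.exists_eq_sum_of_coord (c i) (hc i)
    (A.mem_orderIdeal.1 (A.res_mem_orderIdeal (hle i) hf) (c i))
  choose X hX using fun a => A.exists_glue_of_disjoint W hle le_rfl hd fun i => x i a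
  choose G hG using fun a => A.exists_glue_of_disjoint W hle le_rfl hd fun i => g i a
  refine ⟨X, G, fun a => A.mem_orderIdeal_of_locally fun m hm => ?_,
    fun a => A.mem_orderIdeal_of_locally fun m hm => ?_, A.ext_of_locally fun m hm => ?_⟩ <;>
    obtain ⟨i, hi⟩ := hmem m hm <;> refine ⟨W i, hle i, hi, ?_⟩
  · rw [hX, ← J_eq_orderIdeal]
    exact hx i a
  · rw [hG]
    exact A.mem_orderIdeal_of_coord (c i) (hc i) (hg i a)
  · rw [hs i, map_sum]
    exact Finset.sum_congr rfl fun a _ => by rw [map_mul, hX, hG]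

theorem exists_left_inv_sum {κ : Type*} [Fintype κ] {U : Opens M} (η : κ → A.Sections U)
    (h0 : ∀ k (m : U), 0 ≤ A.base m (η k)) (hpos : ∀ m : U, ∃ k, 0 < A.base m (η k)) :
    ∃ w : A.Sections U, w * ∑ k, η k = 1 := by
  obtain ⟨w, -, hw⟩ := isUnit_iff_exists.1 (A.isUnit_of_base_ne_zero (f := ∑ k, η k) fun m => by
    rw [map_sum]
    obtain ⟨k, hk⟩ := hpos m
    exact (Finset.sum_pos' (fun k _ => h0 k m) ⟨k, Finset.mem_univ k, hk⟩).ne')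
  exact ⟨w, hw⟩

theorem mem_J_pow_of_mem_orderIdeal {k : ℕ} {U : Opens M} {f : A.Sections U}
    (hf : f ∈ A.orderIdeal k U) : f ∈ A.J U ^ k := by
  induction k generalizing f with
  | zero => simp [Submodule.pow_zero, Ideal.one_eq_top]
  | succ k ih =>
    obtain ⟨ι, W, hWU, hU, hd, hW⟩ := A.exists_colored_cover (U := U)
      (fun V => ∃ c : A.Chart, (V : Set M) ⊆ c.chart.source)
      (fun hVW ⟨c, hc⟩ => ⟨c, fun _ hx => hc (hVW hx)⟩) fun m _ => by
        obtain ⟨c, hc⟩ := A.exists_superchart m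
        exact ⟨⟨c.chart.source, c.chart.open_source⟩, hc, c, subset_rfl⟩
    obtain ⟨V, η, hη, hpos⟩ := A.exists_cutoffs W hWU hU hd hW
    -- one factor `η j` is needed to extend each of the two factors of the products `x a * g a`
    have key : ∀ j, η j * η j * f ∈ A.J U ^ (k + 1) := fun j => by
      obtain ⟨x, g, hx, hg, hs⟩ := A.exists_eq_sum_of_disjoint (W j) (hd j) (hW j)
        (A.res_mem_orderIdeal (hη j).le hf)
      choose X hX hX0 hXk using fun a => (hη j).exists_mul_extend (x a)
      choose G hG hG0 hGk using fun a => (hη j).exists_mul_extend (g a)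
      have hsum : η j * η j * f = ∑ a, X a * G a := by
        refine (hη j).ext ?_ ?_
        · rw [map_mul, map_mul, hs, map_sum, Finset.mul_sum]
          refine Finset.sum_congr rfl fun a _ => ?_
          rw [map_mul, hX, hG, mul_assoc, mul_assoc, ← mul_assoc (x a),
            ← (hη j).central _ (hη j).le (x a), mul_assoc]
        · rw [map_mul, map_mul, (hη j).res_eq_zero, zero_mul, zero_mul, map_sum]
          refine (Finset.sum_eq_zero fun a _ => ?_).symm
          rw [map_mul, hX0, zero_mul]
      rw [hsum, Ideal.IsTwoSided.pow_succ]
      refine Submodule.sum_mem _ fun a _ => Ideal.mul_mem_mul ?_ (ih (hGk a k (hg a)))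
      rw [J_eq_orderIdeal]
      exact hXk a 1 (hx a)
    obtain ⟨w, hw⟩ := A.exists_left_inv_sum (fun j => η j * η j)
      (fun j m => by rw [map_mul]; exact mul_self_nonneg _) fun m => by
        obtain ⟨j, hj⟩ := hpos m
        exact ⟨j, by rw [map_mul]; exact mul_pos hj hj⟩
    rw [← one_mul f, ← hw, mul_assoc, Finset.sum_mul]
    exact Ideal.mul_mem_left _ _ (Submodule.sum_mem _ fun j _ => key j)

/-- The ideal `J(U)^k` consists of the sections that are locally of order at least `k`. In
particular membership in it is a local property. -/
theorem J_pow_eq_orderIdeal (k : ℕ) (U : Opens M) : A.J U ^ k = A.orderIdeal k U :=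
  le_antisymm (A.J_pow_le_orderIdeal k U) fun _ => A.mem_J_pow_of_mem_orderIdeal

/-! ### The quotient sheaves -/

/-- Sections over a cover that agree on the overlaps up to order `k` are, up to order `k`, the
restrictions of one section. -/
theorem exists_glue_mod_orderIdeal {ι : Type*} {U : Opens M} (V : ι → Opens M)
    (hV : ∀ i, V i ≤ U) (hU : U ≤ iSup V) (k : ℕ) (f : ∀ i, A.Sections (V i))
    (hf : ∀ i j, A.res inf_le_left (f i) - A.res inf_le_right (f j) ∈
      A.orderIdeal k (V i ⊓ V j)) :
    ∃ F : A.Sections U, ∀ i, A.res (hV i) F - f i ∈ A.orderIdeal k (V i) := by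
  obtain ⟨κ, W, hWU, hWcov, hd, hW⟩ := A.exists_colored_cover (U := U)
    (fun O => (∃ i, O ≤ V i) ∧ ∃ c : A.Chart, (O : Set M) ⊆ c.chart.source)
    (fun hO ⟨⟨i, hi⟩, ⟨c, hc⟩⟩ => ⟨⟨i, hO.trans hi⟩, ⟨c, fun _ hx => hc (hO hx)⟩⟩)
    fun m hm => by
      obtain ⟨c, hc⟩ := A.exists_superchart m
      obtain ⟨i, hi⟩ := Opens.mem_iSup.1 (hU hm)
      exact ⟨V i ⊓ ⟨c.chart.source, c.chart.open_source⟩, ⟨hi, hc⟩, ⟨i, inf_le_left⟩,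
        c, fun _ hx => hx.2⟩
  obtain ⟨V', η, hη, hpos⟩ := A.exists_cutoffs W hWU hWcov hd fun j l => (hW j l).2
  choose e he using fun j l => (hW j l).1
  choose g hg using fun j => A.exists_glue_of_disjoint (W j) (le_iSup (W j)) le_rfl (hd j)
    fun l => A.res (he j l) (f (e j l))
  choose E hE hE0 _ using fun j => (hη j).exists_mul_extend (g j)
  obtain ⟨w, hw⟩ := A.exists_left_inv_sum η (fun j m => (hη j).nonneg m) hpos
  have key : ∀ i j, A.res (hV i) (E j) - A.res (hV i) (η j) * f i ∈ A.orderIdeal k (V i) := by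
    refine fun i j => A.mem_orderIdeal_of_locally fun m hm => ?_
    rcases (hη j).cover (hV i hm) with h | h
    · obtain ⟨l, hl⟩ := Opens.mem_iSup.1 h
      refine ⟨W j l ⊓ V i, inf_le_right, ⟨hl, hm⟩, ?_⟩
      have h1 := congrArg (A.res (inf_le_left.trans (le_iSup (W j) l) : W j l ⊓ V i ≤ _)) (hE j)
      have h2 := congrArg (A.res (inf_le_left : W j l ⊓ V i ≤ _)) (hg j l)
      have h3 := A.res_mem_orderIdeal (inf_le_inf_right (V i) (he j l)) (hf (e j l) i)
      rw [map_mul, A.res_res, A.res_res] at h1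
      rw [A.res_res, A.res_res] at h2
      rw [map_sub, A.res_res, A.res_res] at h3
      rw [map_sub, map_mul, A.res_res, A.res_res, h1, h2, ← mul_sub]
      exact Ideal.mul_mem_left _ _ h3
    · refine ⟨V' j ⊓ V i, inf_le_right, ⟨h, hm⟩, ?_⟩
      have h1 := congrArg (A.res (inf_le_left : V' j ⊓ V i ≤ _)) (hE0 j)
      have h2 := congrArg (A.res (inf_le_left : V' j ⊓ V i ≤ _)) (hη j).res_eq_zero
      rw [A.res_res, map_zero] at h1 h2
      rw [map_sub, map_mul, A.res_res, A.res_res, h1, h2, zero_mul, sub_zero]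
      exact zero_mem _
  refine ⟨w * ∑ j, E j, fun i => ?_⟩
  have h1 : A.res (hV i) w * ∑ j, A.res (hV i) (η j) = 1 := by
    rw [← map_sum, ← map_mul, hw, map_one]
  have h2 : A.res (hV i) (w * ∑ j, E j) - f i =
      A.res (hV i) w * ∑ j, (A.res (hV i) (E j) - A.res (hV i) (η j) * f i) := by
    rw [Finset.sum_sub_distrib, mul_sub, ← Finset.sum_mul, ← mul_assoc, h1, one_mul, map_mul,
      map_sum]
  rw [h2]
  exact Ideal.mul_mem_left _ _ (Submodule.sum_mem _ fun j _ => key i j)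

theorem isSheaf_quotientPresheaf (k : ℕ) : (A.quotientPresheaf k).IsSheaf := by
  rw [TopCat.Presheaf.isSheaf_iff_isSheafUniqueGluing]
  intro ι V sf hsf
  choose f hf using fun i => Ideal.Quotient.mk_surjective (I := A.J (V i) ^ k) (sf i)
  have hle : ∀ i, V i ≤ iSup V := le_iSup V
  have hcomp : ∀ i j, A.res inf_le_left (f i) - A.res inf_le_right (f j) ∈
      A.orderIdeal k (V i ⊓ V j) := fun i j => by
    rw [← J_pow_eq_orderIdeal, ← Ideal.Quotient.eq]
    have := hsf i j
    rw [← hf i, ← hf j] at this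
    exact this
  obtain ⟨F, hF⟩ := A.exists_glue_mod_orderIdeal V hle le_rfl k f hcomp
  refine ⟨Ideal.Quotient.mk (A.J (iSup V) ^ k) F, fun i => ?_, fun s hs => ?_⟩
  · rw [← hf i]
    have h := hF i
    rw [← J_pow_eq_orderIdeal] at h
    exact Ideal.Quotient.eq.2 h
  · obtain ⟨G, rfl⟩ := Ideal.Quotient.mk_surjective (I := A.J (iSup V) ^ k) s
    refine Ideal.Quotient.eq.2 ?_
    rw [J_pow_eq_orderIdeal]
    refine A.mem_orderIdeal_of_locally fun m hm => ?_
    obtain ⟨i, hi⟩ := Opens.mem_iSup.1 hm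
    refine ⟨V i, hle i, hi, ?_⟩
    have h1 : Ideal.Quotient.mk (A.J (V i) ^ k) (A.res (hle i) G) =
        Ideal.Quotient.mk (A.J (V i) ^ k) (f i) := (hs i).trans (hf i).symm
    have h2 := Ideal.Quotient.eq.1 h1
    rw [J_pow_eq_orderIdeal] at h2
    have h3 := sub_mem h2 (hF i)
    rwa [sub_sub_sub_cancel_right, ← map_sub] at h3

/-! ### Completeness -/

theorem exists_limit_of_coord (c : A.Chart) {U : Opens M} (hU : (U : Set M) ⊆ c.chart.source)
    (f : ℕ → A.Sections U) (hf : ∀ k l, k ≤ l → f l - f k ∈ A.orderIdeal k U) :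
    ∃ F : A.Sections U, ∀ k, F - f k ∈ A.orderIdeal k U := by
  -- the coefficient of `ξ^μ` is stationary from the index `|μ| + 1` on
  obtain ⟨F, hF⟩ := (c.coord_bijective hU).2
    ⟨fun μ => (c.coord le_rfl (f (μ.degree + 1))).coeff μ,
      fun μ hμ => FormalSeries.coeff_of_not _ hμ⟩
  refine ⟨F, fun k => A.mem_orderIdeal_of_coord c hU fun μ hμ => ?_⟩
  have h := A.mem_orderIdeal.1 (hf (μ.degree + 1) k hμ) c μ (Nat.lt_succ_self _)
  rw [map_sub, FormalSeries.coeff_sub, sub_eq_zero] at h ⊢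
  rw [h, hF]
  rfl

theorem exists_limit {U : Opens M} (f : ℕ → A.Sections U)
    (hf : ∀ k l, k ≤ l → f l - f k ∈ A.orderIdeal k U) :
    ∃ F : A.Sections U, ∀ k, F - f k ∈ A.orderIdeal k U := by
  choose c hc using A.exists_superchart
  let V : U → Opens M := fun m => U ⊓ ⟨(c m.1).chart.source, (c m.1).chart.open_source⟩
  have hVU : ∀ m, V m ≤ U := fun m => inf_le_left
  choose F hF using fun m : U => A.exists_limit_of_coord (c m.1) (U := V m) (fun x hx => hx.2)
    (fun k => A.res (hVU m) (f k)) fun k l h => by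
      rw [← map_sub]
      exact A.res_mem_orderIdeal _ (hf k l h)
  obtain ⟨G, hG⟩ := A.exists_glue V hVU
    (fun m hm => Opens.mem_iSup.2 ⟨⟨m, hm⟩, hm, hc m⟩) F fun i j => by
      rw [← sub_eq_zero]
      refine A.eq_zero_of_forall_mem_orderIdeal fun k => ?_
      have h := sub_mem
        (A.res_mem_orderIdeal (inf_le_left : V i ⊓ V j ≤ V i) (hF i k))
        (A.res_mem_orderIdeal (inf_le_right : V i ⊓ V j ≤ V j) (hF j k))
      rwa [map_sub, map_sub, A.res_res, A.res_res, sub_sub_sub_cancel_right] at h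
  refine ⟨G, fun k => A.mem_orderIdeal_of_locally fun m hm =>
    ⟨V ⟨m, hm⟩, hVU _, ⟨hm, hc m⟩, ?_⟩⟩
  rw [map_sub, hG]
  exact hF _ k

theorem isHausdorffComplete_J (U : Opens M) : IsHausdorffComplete (A.J U) := by
  constructor
  · rw [injective_iff_map_eq_zero]
    intro f hf
    refine A.eq_zero_of_forall_mem_orderIdeal fun k => ?_
    rw [← J_pow_eq_orderIdeal, ← Ideal.Quotient.eq_zero_iff_mem]
    exact congrFun (congrArg Subtype.val hf) k
  · rintro ⟨s, hs⟩
    choose f hf using fun k => Ideal.Quotient.mk_surjective (I := A.J U ^ k) (s k)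
    obtain ⟨F, hF⟩ := A.exists_limit f fun k l h => by
      rw [← J_pow_eq_orderIdeal, ← Ideal.Quotient.eq, hf k, ← hs k l h, ← hf l]
      rfl
    refine ⟨F, Subtype.ext (funext fun k => ?_)⟩
    have h := hF k
    rw [← J_pow_eq_orderIdeal] at h
    exact (Ideal.Quotient.eq.2 h).trans (hf k)

/-- The components at `U` of a cone over the inverse system of the quotient sheaves, combined into
a map to the inverse limit of the algebras `A(U) / J(U)^k`. -/
def coneToAdicLimit {h : ∀ k, (A.quotientPresheaf k).IsSheaf} (s : Cone (A.quotientSystem h))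
    (U : Opens M) : s.pt.obj.obj (op U) →ₐ[ℝ] adicLimit (A.J U) :=
  (AlgHom.pi fun k => ((s.π.app (op k)).hom.app (op U)).hom).codRestrict _
    fun x k l hkl => by
      have := s.w (homOfLE hkl).op
      exact congrArg (fun φ => (φ.hom.app (op U)).hom x) this

/-- The section of `A` determined by its classes modulo the powers of `J`. -/
def ofAdicLimit (U : Opens M) : adicLimit (A.J U) →ₐ[ℝ] A.Sections U :=
  (AlgEquiv.ofBijective _ (A.isHausdorffComplete_J U)).symm.toAlgHom

theorem mk_ofAdicLimit {U : Opens M} (s : adicLimit (A.J U)) (k : ℕ) :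
    Ideal.Quotient.mk (A.J U ^ k) (A.ofAdicLimit U s) = s.1 k :=
  congrFun (congrArg Subtype.val
    ((AlgEquiv.ofBijective _ (A.isHausdorffComplete_J U)).apply_symm_apply s)) k

theorem ext_of_forall_mk {U : Opens M} {f g : A.Sections U}
    (h : ∀ k, Ideal.Quotient.mk (A.J U ^ k) f = Ideal.Quotient.mk (A.J U ^ k) g) : f = g :=
  (A.isHausdorffComplete_J U).1 (Subtype.ext (funext h))

/-- Since limits of sheaves are computed on sections, completeness of all `A(U)` means that `A` is
the limit of the quotient sheaves. -/
def isLimitQuotientCone (h : ∀ k, (A.quotientPresheaf k).IsSheaf) :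
    IsLimit (A.quotientCone h) where
  lift s := ObjectProperty.homMk
    { app := fun U => AlgCat.ofHom ((A.ofAdicLimit U.unop).comp (A.coneToAdicLimit s U.unop))
      naturality := fun U V i => by
        ext x
        refine A.ext_of_forall_mk fun k => ?_
        have h1 := congrArg (fun φ => φ.hom x) ((s.π.app (op k)).hom.naturality i)
        refine (A.mk_ofAdicLimit _ k).trans (h1.trans ?_)
        have h2 := A.mk_ofAdicLimit (A.coneToAdicLimit s U.unop x) k
        exact congrArg (((A.quotientPresheaf k).map i).hom) h2.symm }
  fac s j := by
    apply Sheaf.hom_ext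
    ext U x
    exact A.mk_ofAdicLimit (A.coneToAdicLimit s U.unop x) j.unop
  uniq s m hm := by
    apply Sheaf.hom_ext
    ext U x
    refine A.ext_of_forall_mk fun k => ?_
    refine Eq.trans ?_ (A.mk_ofAdicLimit (A.coneToAdicLimit s U.unop x) k).symm
    exact congrArg (fun φ => (φ.hom.app U).hom x) (hm (op k))

end Supermanifold

end Z2nGeometry

end

theorem proposition6p7 {n q p : ℕ} (σ : Fin q → {g : Fin n → ZMod 2 // g ≠ 0}) (M : TopCat.{u})
    [T2Space M] [SecondCountableTopology M] (A : Z2nGeometry.Supermanifold p σ M) :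
    (∃ h : ∀ k : ℕ, (A.quotientPresheaf k).IsSheaf,
      Nonempty (Limits.IsLimit (A.quotientCone h))) ∧
    ∀ U : Opens M, Z2nGeometry.IsHausdorffComplete (A.J U) :=
  ⟨⟨A.isSheaf_quotientPresheaf, ⟨A.isLimitQuotientCone _⟩⟩, A.isHausdorffComplete_J⟩
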